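/- **Setting.** Let $d\ge 1$ and $p\ge 2$ be integers ($p$ need not be prime) and let $K$ be a global field, with $\operatorname{char}K$ coprime to $p$ if it is positive; $\mathcal O_K$ is its ring of integers (the integral closure of $\mathbb Z$, or of $\mathbb F_q[t]$ for some $t\in K$ transcendental over the prime field $\mathbb F_q$ with $K/\mathbb F_q(t)$ finite). Let $R=\mathcal O_K[a_{j,k},b_{j,k}:1\le j\le d,\,0\le k<p]$ be the polynomial ring in $2dp$ indeterminates and $\mathcal R=R[x_1,\dots,x_d]/\langle(1-a_{1,0})x_1-1,\dots,(1-a_{d,0})x_d-1\rangle$. Let $\mathbb Z_p=\varprojlim\mathbb Z/p^n$, let $[\mathfrak z]_{p^n}\in\{0,\dots,p^n-1\}$ be the residue of $\mathfrak z\in\mathbb Z_p$, $\theta_p(\mathfrak z)=(\mathfrak z-[\mathfrak z]_p)/p$, and $\#_{p:k}(m)$ the number of digits $k$ in the base $p$ expansion of $m\in\mathbb N_0$. Let $\hat{\mathbb Z}_p=\mathbb Z[1/p]/\mathbb Z$; for $t\in\hat{\mathbb Z}_p$, $|t|_p=p^n$ where $n\ge0$ is minimal with $p^nt=0$, and $v_p(t)=-n$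 if $t\ne0$. An (evaluative, multiplicative) *frame* for a ring $A$ with domain $D\subseteq\mathbb Z_p$ attaches to each $\mathfrak z\in D$ an absolute value $|\cdot|_{\mathcal F(\mathfrak z)}$ on $A$. Its compatible functions $C(\mathcal F)$ are the families $(f(\mathfrak z))_{\mathfrak z\in D}$ with $f(\mathfrak z)$ in the completion of $A$ for $|\cdot|_{\mathcal F(\mathfrak z)}$. It is *reffinite* if $\mathbb N_0\subseteq D$, $\theta_p(D)\subseteq D$, and $|\cdot|_{\mathcal F(\theta_p(\mathfrak z))}=|\cdot|_{\mathcal F(\mathfrak z)}$. It is *digital* if there are absolute values $v_0,\dots,v_{p-1}$ with $|\cdot|_{\mathcal F(\mathfrak z)}=v_k$ whenever $\mathfrak z\in D\cap D_k$, where $D_0=\mathbb N_0$ and, for $k\ge1$, $D_k$ is the set of $\mathfrak z$ having infinitely many digits $k$ but not infinitely many digits $i$ for any $1\le i<k$. A function $f\in C(\mathcal F)$ is *rising-continuous* if $f(m)\in A$ for $m\in\mathbb N_0$ and $f([\mathfrak z]_{p^n})\to f(\mathfrak z)$ in the completion at $\mathfrak z$ for every $\mathfrak z\in D$. Let $\mathcal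 F$ be a reffinite digital frame for $\mathcal R$ with domain $D$ such that, for all $\mathfrak z\in D$ and all $j$, $$|a_{j,0}|_{\mathcal F(\mathfrak z)}\limsup_{n\to\infty}\Bigl(\prod_{k=1}^{p-1}\bigl(|a_{j,k}|_{\mathcal F(\mathfrak z)}/|a_{j,0}|_{\mathcal F(\mathfrak z)}\bigr)^{\#_{p:k}([\mathfrak z]_{p^n})}\Bigr)^{1/n}<1 .$$ Let $I$ be an ideal of $R$ with $\langle1-a_{j,0}\rangle\not\subseteq I$ for all $j$, and put $A=\mathcal R/I\mathcal R$. Suppose that $p\ne0$ in $A$ and that the quotient frame $\mathcal G=\mathcal F/I\mathcal R$, with domain $D$ and seminorms $\mathcal G_{\mathfrak z}(f)=\inf_g|f(\mathfrak z)+g(\mathfrak z)|_{\mathcal F(\mathfrak z)}$ ($g$ ranging over the $I\mathcal R$-valued functions on $D$), is again a frame in the above sense, i.e. is given by absolute values $|\cdot|_{\mathcal G(\mathfrak z)}$ on $A$. Then $A$ is a domain; let $F=\operatorname{Frac}(A)$ and $L=F(\zeta_{p^\infty})$, extend each $|\cdot|_{\mathcal G(\mathfrak z)}$ to $F$, and fix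 an injective character $t\mapsto e^{2\pi it}$ from $\hat{\mathbb Z}_p$ to $L^\times$. A function $\hat f:\hat{\mathbb Z}_p\to L$ is a *Fourier transform* of $f$ (and $f$ is then $\mathcal G$-*quasi-integrable*) if for every $\mathfrak z\in D$ the partial sums $\sum_{|t|_p\le p^N}\hat f(t)e^{2\pi i\{t\mathfrak z\}_p}$ lie in $F$ and converge to $f(\mathfrak z)$ with respect to $|\cdot|_{\mathcal G(\mathfrak z)}$ as $N\to\infty$. **I.** For each $j$ there is a unique rising-continuous $X_j\in C(\mathcal G)$ with $X_j(\mathfrak z)=a_{j,[\mathfrak z]_p}X_j(\theta_p(\mathfrak z))+b_{j,[\mathfrak z]_p}$ in the completion at $\mathfrak z$, for all $\mathfrak z\in D$. **II.** For $\mathbf m\le\mathbf n$ in $\mathbb N_0^d$ (componentwise; $\mathbf m<\mathbf n$ means $\mathbf m\le\mathbf n$ and $\mathbf m\ne\mathbf n$) put $r_{\mathbf m,\mathbf n,k}=\prod_j\binom{n_j}{m_j}a_{j,k}^{m_j}b_{j,k}^{n_j-m_j}$, $\alpha_{\mathbf m,\mathbf n}(t)=\frac1p\sum_{k=0}^{p-1}r_{\mathbf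 m,\mathbf n,k}e^{-2\pi ikt}$, $\alpha_{\mathbf n}=\alpha_{\mathbf n,\mathbf n}$, $\hat A_{\mathbf n}(t)=\prod_{i=0}^{-v_p(t)-1}\alpha_{\mathbf n}(p^it)$. There is a unique family of functions $\hat X_{\mathbf n}:\hat{\mathbb Z}_p\to L$, $\mathbf n\in\mathbb N_0^d$, with $\hat X_{\mathbf 0}=\mathbf 1_0$ (the indicator function of $0$) and $\hat X_{\mathbf n}=\hat f_{\mathbf n}-\hat g_{\mathbf n}$ for $\mathbf n\ne\mathbf 0$, where $$\hat f_{\mathbf n}(t)=\sum_{\mathbf m<\mathbf n}\ \sum_{i=0}^{-v_p(t)-2}\Bigl(\prod_{h=0}^{i-1}\alpha_{\mathbf n}(p^ht)\Bigr)\alpha_{\mathbf m,\mathbf n}(p^it)\hat X_{\mathbf m}(p^{i+1}t)\quad(\text{empty for }t=0),$$ and where, with $c_{\mathbf n,k}=-\sum_{\mathbf m<\mathbf n}r_{\mathbf m,\mathbf n,k}\hat X_{\mathbf m}(0)$, $\beta_{\mathbf n}(t)=\frac1p\sum_kc_{\mathbf n,k}e^{-2\pi ikt}$, $\gamma_{\mathbf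 n}=\beta_{\mathbf n}/\alpha_{\mathbf n}$: if $\alpha_{\mathbf n}(0)=1$, then $\hat g_{\mathbf n}(0)=0$ and $\hat g_{\mathbf n}(t)=\bigl(\beta_{\mathbf n}(0)v_p(t)+\gamma_{\mathbf n}(t|t|_p/p)\bigr)\hat A_{\mathbf n}(t)$ for $t\neq0$; if $\alpha_{\mathbf n}(0)\ne1$, then $\hat g_{\mathbf n}(0)=\frac{\beta_{\mathbf n}(0)}{1-\alpha_{\mathbf n}(0)}$ and $\hat g_{\mathbf n}(t)=\bigl(\frac{\beta_{\mathbf n}(0)}{1-\alpha_{\mathbf n}(0)}+\gamma_{\mathbf n}(t|t|_p/p)\bigr)\hat A_{\mathbf n}(t)$ for $t\ne0$. (Here $\gamma_{\mathbf n}(t|t|_p/p)\hat A_{\mathbf n}(t)$ stands for $\beta_{\mathbf n}(t|t|_p/p)\prod_{i=0}^{-v_p(t)-2}\alpha_{\mathbf n}(p^it)$, the factor $\alpha_{\mathbf n}(t|t|_p/p)$ being cancelled.) For every $\mathbf n$, $X_{\mathbf n}=\prod_jX_j^{n_j}$ is $\mathcal G$-quasi-integrable with Fourier transform $\hat X_{\mathbf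 n}$. **III.** For every $\mathbf n$ there is a unique distribution $X_{\mathbf n}d\mathfrak z$, i.e. $F$-linear functional on the space of locally constant functions $\mathbb Z_p\to F$, whose Fourier–Stieltjes transform $t\mapsto\int e^{-2\pi i\{t\mathfrak z\}_p}X_{\mathbf n}d\mathfrak z$ is $\hat X_{\mathbf n}$. Let $k$ be any field contained in $F$ (for example $K$, if $\mathcal O_K\to F$ is injective), and let the formal pointwise product and the formal convolution be defined by $X_{\mathbf m}d\mathfrak z\cdot X_{\mathbf n}d\mathfrak z:=X_{\mathbf m+\mathbf n}d\mathfrak z$ and $\hat X_{\mathbf m}*\hat X_{\mathbf n}:=\hat X_{\mathbf m+\mathbf n}$; that is, the monomial $x^{\mathbf n}$ of the polynomial algebra $k[x_1,\dots,x_d]$ is realized as the distribution $X_{\mathbf n}d\mathfrak z=\prod_j(X_jd\mathfrak z)^{n_j}$ and as the function $\hat X_{\mathbf n}=\bigstar_j\hat X_j^{*n_j}$. 1. For every $P\in k[x_1,\dots,x_d]$, the Fourier–Stieltjes transform maps the distribution realizing $P$ to the function $\hat P$ realizing $P$, and $\hat P$ is a Fourier transform of $P(X_1,\dots,X_d)$.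 2. The transform is a $k$-linear isomorphism from the span of the $X_{\mathbf n}d\mathfrak z$ onto the span of the $\hat X_{\mathbf n}$. The formal product is a well-defined bilinear product on the first span if and only if the formal convolution is one on the second, and the transform then carries one to the other. 3. If $X_1,\dots,X_d$ are algebraically independent over $k$ as functions on $D$, then these products are well-defined, and the realization $k[x_1,\dots,x_d]\to\operatorname{span}_k\{X_{\mathbf n}d\mathfrak z\}$ is an isomorphism of algebras; so the Fourier transform is an isomorphism from the polynomial algebra $k[X_1d\mathfrak z,\dots,X_dd\mathfrak z]$ onto the convolution algebra generated by $\hat X_1,\dots,\hat X_d$. 4. If $I=0$ (indeterminate parameters), then $K\subseteq F$ and $X_1,\dots,X_d$ are algebraically independent over $K$. -/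

import Mathlib

open Filter Topology

noncomputable section

namespace FSeries

/-! ### The `p`-adic integers for an arbitrary integer `p ≥ 2` -/

/-- The ring `ℤ_p = lim ℤ/pⁿ` of `p`-adic integers, for an integer `p` that need not be prime, as a
set: a point `z` is the coherent sequence of its residues `[z]_{pⁿ} ∈ {0, …, pⁿ - 1}`. -/
def Zp (p : ℕ) : Type :=
  {z : ℕ → ℕ // ∀ n, z n < p ^ n ∧ z (n + 1) % p ^ n = z n}

namespace Zp

variable {p : ℕ}

/-- The residue `[z]_{pⁿ}`. -/
def res (z : Zp p) (n : ℕ) : ℕ := z.1 n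

theorem res_mod (z : Zp p) {m n : ℕ} (h : m ≤ n) : z.res n % p ^ m = z.res m := by
  induction n, h using Nat.le_induction with
  | base => exact Nat.mod_eq_of_lt (z.2 m).1
  | succ n hmn ih =>
    rw [← ih, ← Nat.mod_mod_of_dvd _ (pow_dvd_pow p hmn)]
    exact congrArg (· % p ^ m) (z.2 n).2

/-- The embedding of the non-negative integers. -/
def ofNat (p : ℕ) [NeZero p] (m : ℕ) : Zp p :=
  ⟨fun n => m % p ^ n, fun n =>
    ⟨Nat.mod_lt _ (pow_pos (NeZero.pos p) n), Nat.mod_mod_of_dvd _ (pow_dvd_pow p n.le_succ)⟩⟩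

/-- The shift `θ_p(z) = (z - [z]_p) / p`, which deletes the lowest digit. -/
def shift [NeZero p] (z : Zp p) : Zp p :=
  ⟨fun n => z.1 (n + 1) / p, fun n => by
    have hp : 0 < p := NeZero.pos p
    refine ⟨?_, ?_⟩
    · rw [Nat.div_lt_iff_lt_mul hp, ← pow_succ]
      exact (z.2 (n + 1)).1
    · rw [← Nat.mod_mul_right_div_self, ← pow_succ', (z.2 (n + 1)).2]⟩

/-- The lowest digit `[z]_p`. -/
def digit (z : Zp p) : Fin p :=
  ⟨z.res 1, by simpa [res] using (z.2 1).1⟩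

/-- The digit `k` occurs infinitely often in the `p`-adic expansion of `z`. -/
def HasInfinitelyMany [NeZero p] (z : Zp p) (k : ℕ) : Prop :=
  {i : ℕ | ((shift^[i] z).digit : ℕ) = k}.Infinite

/-- The pieces `D_0, …, D_{p-1}` of the digit construction: `D_0 = ℕ`, and for `k ≥ 1` the set `D_k`
consists of the `z` that have infinitely many digits `k`, but not infinitely many digits `i` for any
`1 ≤ i < k`. -/
def digitDomain [NeZero p] (k : Fin p) : Set (Zp p) :=
  if k = 0 then Set.range (ofNat p)
  else {z | z.HasInfinitelyMany k ∧ ∀ i : ℕ, 1 ≤ i → i < k → ¬ z.HasInfinitelyMany i}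

end Zp

/-- `#_{p:k}(m)`, the number of digits `k` in the base `p` expansion of `m`. -/
def digitCount (p k m : ℕ) : ℕ := (Nat.digits p m).count k

/-! ### Frames -/

/-- A (multiplicative, evaluative) `R`-frame with domain `D`: an absolute value `|·|_{F(x)}` on `R`
for every `x ∈ D`. -/
structure Frame {𝒳 : Type*} (D : Set 𝒳) (R : Type*) [CommRing R] where
  /-- the absolute value attached to a point of the domain -/
  abv : D → AbsoluteValue R ℝ

namespace Frame

variable {𝒳 : Type*} {D : Set 𝒳} {R : Type*} [CommRing R]

/-- The seminorm `F_x(f) = |f(x)|_{F(x)}` on the ring of functions `D → R`. -/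
def seminorm (F : Frame D R) (x : D) (f : D → R) : ℝ := F.abv x (f x)

/-- The completion of `R` with respect to `|·|_{F(x)}`. -/
abbrev Compl (F : Frame D R) (x : D) : Type _ := UniformSpace.Completion (WithAbs (F.abv x))

/-- The space `C(F)` of compatible functions. -/
abbrev Compat (F : Frame D R) : Type _ := (x : D) → F.Compl x

/-- The canonical map from `R` to its completion at `x`. -/
def coe (F : Frame D R) (x : D) (r : R) : F.Compl x :=
  ((WithAbs.toAbs (F.abv x) r : WithAbs (F.abv x)) : UniformSpace.Completion (WithAbs (F.abv x)))

/-- `G` is the quotient frame `F / J`: the frame on `R / J` with the same domain for which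
`G_x(f mod J) = inf_g F_x(f + g)`, with `g` ranging over the `J`-valued functions. -/
def IsQuotient (F : Frame D R) (J : Ideal R) (G : Frame D (R ⧸ J)) : Prop :=
  ∀ (x : D) (f : D → R),
    G.seminorm x (fun y => Ideal.Quotient.mk J (f y)) =
      ⨅ g : D → J, F.seminorm x (fun y => f y + (g y : R))

variable {p : ℕ} [NeZero p] {E : Set (Zp p)}

/-- Reffinite frames on `ℤ_p`. -/
structure IsReffinite (F : Frame E R) : Prop where
  nat_mem : ∀ m : ℕ, Zp.ofNat p m ∈ E
  shift_mem : ∀ z ∈ E, z.shift ∈ E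
  abv_shift : ∀ z : E, F.abv ⟨z.1.shift, shift_mem z.1 z.2⟩ = F.abv z

/-- Digital frames on `ℤ_p`: the absolute value is constant on every piece of the digit
construction. -/
def IsDigital (F : Frame E R) : Prop :=
  ∃ v : Fin p → AbsoluteValue R ℝ,
    ∀ (z : E) (k : Fin p), z.1 ∈ Zp.digitDomain k → F.abv z = v k

/-- A quotient of a reffinite frame is reffinite. -/
theorem IsReffinite.quotient {F : Frame E R} (hF : F.IsReffinite) {J : Ideal R}
    {G : Frame E (R ⧸ J)} (hG : F.IsQuotient J G) : G.IsReffinite where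
  nat_mem := hF.nat_mem
  shift_mem := hF.shift_mem
  abv_shift z := by
    ext r
    obtain ⟨r, rfl⟩ := Ideal.Quotient.mk_surjective r
    have h₁ := hG ⟨z.1.shift, hF.shift_mem z.1 z.2⟩ (fun _ => r)
    have h₂ := hG z (fun _ => r)
    simp only [seminorm, hF.abv_shift z] at h₁ h₂
    rw [h₁, h₂]
    refine le_antisymm ?_ ?_
    · refine le_ciInf fun g => ?_
      refine (ciInf_le ⟨0, ?_⟩ (fun _ => g z)).trans le_rfl
      rintro _ ⟨g, rfl⟩
      exact (F.abv z).nonneg _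
    · refine le_ciInf fun g => ?_
      refine (ciInf_le ⟨0, ?_⟩ (fun _ => g ⟨z.1.shift, hF.shift_mem z.1 z.2⟩)).trans le_rfl
      rintro _ ⟨g, rfl⟩
      exact (F.abv z).nonneg _

/-- `C(F) ∋ f` is rising-continuous: `f(z) = lim f([z]_{pⁿ})` for all `z` in the domain. As the value
`f([z]_{pⁿ})` has to make sense in the completion at `z`, the values at the non-negative integers
are asked to be elements `f₀ m` of the ring `R` itself. -/
def RisingContinuous (F : Frame E R) (hF : F.IsReffinite) (f : F.Compat) : Prop :=
  ∃ f₀ : ℕ → R, (∀ m, f ⟨Zp.ofNat p m, hF.nat_mem m⟩ = F.coe _ (f₀ m)) ∧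
    ∀ z : E, Tendsto (fun n => F.coe z (f₀ (z.1.res n))) atTop (𝓝 (f z))

/-- The identification of the completions with respect to two equal absolute values. -/
def completionCast {v w : AbsoluteValue R ℝ} (h : v = w)
    (x : UniformSpace.Completion (WithAbs v)) : UniformSpace.Completion (WithAbs w) :=
  h ▸ x

/-- The functional equation `f(z) = a_{[z]_p} f(θ_p(z)) + b_{[z]_p}` in the completion at `z`, for
every `z` in the domain. -/
def FunctionalEquation (F : Frame E R) (hF : F.IsReffinite) (a b : Fin p → R) (f : F.Compat) :
    Prop :=
  ∀ z : E, f z = F.coe z (a z.1.digit) *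
      completionCast (hF.abv_shift z) (f ⟨z.1.shift, hF.shift_mem z.1 z.2⟩) +
    F.coe z (b z.1.digit)

/-- `f` is a rising-continuous solution of the functional equation. -/
def IsRisingSolution (F : Frame E R) (hF : F.IsReffinite) (a b : Fin p → R) (f : F.Compat) : Prop :=
  F.RisingContinuous hF f ∧ F.FunctionalEquation hF a b f

/-- The root condition on the parameters `a_0, …, a_{p-1}`:
`|a_0| limsup_n (∏_{k=1}^{p-1} (|a_k| / |a_0|) ^ #_{p:k}([z]_{pⁿ})) ^ (1/n) < 1` in `F(z)`, for every
`z` in the domain. -/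
def RootCondition (F : Frame E R) (a : Fin p → R) : Prop :=
  ∀ z : E, F.abv z (a 0) *
    limsup (fun n : ℕ =>
      (∏ k ∈ Finset.univ.erase (0 : Fin p),
        (F.abv z (a k) / F.abv z (a 0)) ^ digitCount p k (z.1.res n)) ^ (1 / (n : ℝ))) atTop < 1

end Frame

/-! ### The dual group and roots of unity -/

/-- `ℤ[1/p]/ℤ`, the Pontryagin dual of `ℤ_p`, as the group of elements of `ℚ/ℤ` that are killed by a
power of `p`. -/
def Zhat (p : ℕ) : AddSubgroup (AddCircle (1 : ℚ)) where
  carrier := {t | ∃ n : ℕ, p ^ n • t = 0}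
  zero_mem' := ⟨0, by simp⟩
  add_mem' := by
    rintro s t ⟨m, hm⟩ ⟨n, hn⟩
    refine ⟨m + n, ?_⟩
    rw [pow_add, smul_add, mul_comm, mul_smul, hm, smul_zero, mul_comm, mul_smul, hn, smul_zero,
      add_zero]
  neg_mem' := by
    rintro t ⟨n, hn⟩
    exact ⟨n, by rw [smul_neg, hn, neg_zero]⟩

namespace Zhat

variable {p : ℕ}

/-- The exponent `n` with `|t|_p = pⁿ`, that is `-v_p(t)` for `t ≠ 0`; it is `0` for `t = 0`. -/
def level (t : Zhat p) : ℕ := sInf {n : ℕ | p ^ n • t = 0}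

/-- The element `k / pᴺ`. -/
def frac (p : ℕ) [NeZero p] (N k : ℕ) : Zhat p :=
  ⟨(((k : ℚ) / (p : ℚ) ^ N : ℚ) : AddCircle (1 : ℚ)), N, by
    have hp : (p : ℚ) ^ N ≠ 0 := pow_ne_zero _ (Nat.cast_ne_zero.2 (NeZero.ne p))
    rw [← AddCircle.coe_nsmul, AddCircle.coe_eq_zero_iff]
    refine ⟨k, ?_⟩
    simp only [nsmul_eq_mul, zsmul_eq_mul]
    push_cast
    field_simp⟩

/-- The duality pairing `{t z}_p ∈ ℤ[1/p]/ℤ`. -/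
def pairing (t : Zhat p) (z : Zp p) : Zhat p := z.res (level t) • t

end Zhat

/-! ### The Fourier transforms `X̂_n` -/

section Coefficients

variable {d p : ℕ} {L : Type*} [Field L] (e : AddChar (Zhat p) L) (a b : Fin d → Fin p → L)

/-- `r_{m,n,k} = binom(n,m) ∏_j a_{j,k}^{m_j} b_{j,k}^{n_j - m_j}`, used for `m ≤ n` only. -/
def coeffR (m n : Fin d → ℕ) (k : Fin p) : L :=
  (∏ j, ((n j).choose (m j) : L)) * (∏ j, a j k ^ m j) * ∏ j, b j k ^ (n j - m j)

/-- `α_{m,n}(t) = (1/p) ∑_k r_{m,n,k} e^{-2πikt}`. -/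
def alpha (m n : Fin d → ℕ) (t : Zhat p) : L :=
  1 / (p : L) * ∑ k : Fin p, coeffR a b m n k * e (-((k : ℕ) • t))

/-- `Â_n(t) = ∏_{i=0}^{-v_p(t)-1} α_n(pⁱ t)`. -/
def Ahat (n : Fin d → ℕ) (t : Zhat p) : L :=
  ∏ i ∈ Finset.range (Zhat.level t), alpha e a b n n (p ^ i • t)

variable (Xh : (Fin d → ℕ) → Zhat p → L)

/-- `c_{n,k} = -∑_{m<n} r_{m,n,k} X̂_m(0)`. -/
def coeffC (n : Fin d → ℕ) (k : Fin p) : L :=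
  -∑ m ∈ Finset.Iio n, coeffR a b m n k * Xh m 0

/-- `β_n(t) = (1/p) ∑_k c_{n,k} e^{-2πikt}`. -/
def beta (n : Fin d → ℕ) (t : Zhat p) : L :=
  1 / (p : L) * ∑ k : Fin p, coeffC a b Xh n k * e (-((k : ℕ) • t))

/-- `γ_n(t) = β_n(t) / α_n(t)`. -/
def gamma (n : Fin d → ℕ) (t : Zhat p) : L := beta e a b Xh n t / alpha e a b n n t

/-- The product `γ_n(t|t|_p/p) Â_n(t)` for `t ≠ 0`. The last factor of `Â_n(t)` is the denominator
`α_n(t|t|_p/p)` of `γ_n(t|t|_p/p)`; it is cancelled here, so that the expression also makes sense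
when it vanishes. -/
def gammaAhat (n : Fin d → ℕ) (t : Zhat p) : L :=
  beta e a b Xh n (p ^ (Zhat.level t - 1) • t) *
    ∏ i ∈ Finset.range (Zhat.level t - 1), alpha e a b n n (p ^ i • t)

theorem gammaAhat_eq (n : Fin d → ℕ) (t : Zhat p) (ht : Zhat.level t ≠ 0)
    (h : alpha e a b n n (p ^ (Zhat.level t - 1) • t) ≠ 0) :
    gammaAhat e a b Xh n t = gamma e a b Xh n (p ^ (Zhat.level t - 1) • t) * Ahat e a b n t := by
  obtain ⟨N, hN⟩ := Nat.exists_eq_succ_of_ne_zero ht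
  simp only [gammaAhat, gamma, Ahat, hN, Nat.succ_eq_add_one, Nat.add_sub_cancel,
    Finset.prod_range_succ] at h ⊢
  field_simp

/-- `f̂_n(t) = ∑_{m<n} ∑_{i=0}^{-v_p(t)-2} (∏_{h=0}^{i-1} α_n(pʰ t)) α_{m,n}(pⁱ t) X̂_m(pⁱ⁺¹ t)`. -/
def fhat (n : Fin d → ℕ) (t : Zhat p) : L :=
  ∑ m ∈ Finset.Iio n, ∑ i ∈ Finset.range (Zhat.level t - 1),
    (∏ h ∈ Finset.range i, alpha e a b n n (p ^ h • t)) * alpha e a b m n (p ^ i • t) *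
      Xh m (p ^ (i + 1) • t)

open Classical in
/-- `ĝ_n(t)`, in the cases `α_n(0) = 1` and `α_n(0) ≠ 1`; note `v_p(t) = -level t`. -/
def ghat (n : Fin d → ℕ) (t : Zhat p) : L :=
  if alpha e a b n n 0 = 1 then
    if t = 0 then 0
    else beta e a b Xh n 0 * (-(Zhat.level t : L)) * Ahat e a b n t + gammaAhat e a b Xh n t
  else
    if t = 0 then beta e a b Xh n 0 / (1 - alpha e a b n n 0)
    else beta e a b Xh n 0 / (1 - alpha e a b n n 0) * Ahat e a b n t + gammaAhat e a b Xh n t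

open Classical in
/-- The recursive description of the functions `X̂_n`, `n ∈ ℕ^d`: `X̂_0` is the indicator function of
`0`, and `X̂_n = f̂_n - ĝ_n` for `n ≠ 0`, where `f̂_n` and `ĝ_n` involve the `X̂_m` with `m < n`. -/
def IsFourierFamily : Prop :=
  (Xh 0 = fun t => if t = 0 then 1 else 0) ∧
    ∀ n : Fin d → ℕ, n ≠ 0 → ∀ t, Xh n t = fhat e a b Xh n t - ghat e a b Xh n t

end Coefficients

/-! ### Quasi-integrability -/

section QuasiIntegrable

variable {p : ℕ} [NeZero p] {E : Set (Zp p)} {A : Type*} [CommRing A]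
  {F : Type*} [Field F] [Algebra A F] {L : Type*} [Field L] [Algebra F L]

/-- The partial sum `∑_{|t|_p ≤ pᴺ} f̂(t) e^{2πi{tz}_p}` of a Fourier series. -/
def partialSum (e : AddChar (Zhat p) L) (fh : Zhat p → L) (z : Zp p) (N : ℕ) : L :=
  ∑ k ∈ Finset.range (p ^ N), fh (Zhat.frac p N k) * e (Zhat.pairing (Zhat.frac p N k) z)

/-- For an absolute value `w` on the field `F`: the partial sums of the Fourier series of `f̂` at `z`
belong to `F`, and converge to `x` in the completion of `F` with respect to `w`. -/
def FourierSeriesTendsto (e : AddChar (Zhat p) L) (fh : Zhat p → L) (z : Zp p)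
    (w : AbsoluteValue F ℝ) (x : UniformSpace.Completion (WithAbs w)) : Prop :=
  ∃ s : ℕ → F, (∀ N, algebraMap F L (s N) = partialSum e fh z N) ∧
    Tendsto (fun N => ((WithAbs.toAbs w (s N) : WithAbs w) :
      UniformSpace.Completion (WithAbs w))) atTop (𝓝 x)

/-- The map from the completion of `A` to that of the field `F`, when `w` extends `v`. -/
def fracMap (v : AbsoluteValue A ℝ) (w : AbsoluteValue F ℝ)
    (x : UniformSpace.Completion (WithAbs v)) : UniformSpace.Completion (WithAbs w) :=
  UniformSpace.Completion.map (WithAbs.map v w (algebraMap A F)) x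

/-- The absolute value `w` on `F` extends the absolute value `v` on `A`. If `F` is the field of
fractions of `A`, there is exactly one such `w`. -/
def Extends (v : AbsoluteValue A ℝ) (w : AbsoluteValue F ℝ) : Prop :=
  ∀ r : A, w (algebraMap A F r) = v r

variable (F)

/-- `f̂` is a Fourier transform of `f ∈ C(G)` with respect to `G`: for all `z` in the domain, the
partial sums of the Fourier series of `f̂` at `z` converge to `f(z)` with respect to the absolute
value `|·|_{G(z)}`, extended to the field of fractions `F` of `A`. -/
def IsFourierTransform (G : Frame E A) (e : AddChar (Zhat p) L) (fh : Zhat p → L)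
    (f : G.Compat) : Prop :=
  ∀ z : E, ∃ w : AbsoluteValue F ℝ, Extends (G.abv z) w ∧
    FourierSeriesTendsto e fh z.1 w (fracMap (G.abv z) w (f z))

/-- Quasi-integrability with respect to the frame `G`. -/
def IsQuasiIntegrable (G : Frame E A) (e : AddChar (Zhat p) L) (f : G.Compat) : Prop :=
  ∃ fh : Zhat p → L, IsFourierTransform F G e fh f

end QuasiIntegrable

/-! ### Schwartz-Bruhat functions and distributions -/

section Distributions

variable (p : ℕ) (F : Type*) [Field F]

/-- The space `S(ℤ_p, F)` of locally constant functions. -/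
def SB : Submodule F (Zp p → F) where
  carrier := {φ | ∃ N, ∀ y z : Zp p, y.res N = z.res N → φ y = φ z}
  zero_mem' := ⟨0, fun _ _ _ => rfl⟩
  add_mem' := by
    rintro φ ψ ⟨M, hM⟩ ⟨N, hN⟩
    refine ⟨max M N, fun y z h => ?_⟩
    simp only [Pi.add_apply]
    rw [hM y z, hN y z]
    · rw [← y.res_mod (le_max_right M N), h, z.res_mod (le_max_right M N)]
    · rw [← y.res_mod (le_max_left M N), h, z.res_mod (le_max_left M N)]
  smul_mem' := by
    rintro c φ ⟨N, hN⟩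
    exact ⟨N, fun y z h => by simp only [Pi.smul_apply, hN y z h]⟩

/-- The space `S(ℤ_p, F)'` of distributions. -/
abbrev Distribution : Type _ := Module.Dual F (SB p F)

variable {p}

open Classical in
/-- The function `[z ≡ k mod pᴺ]`. -/
def SB.indicator (N k : ℕ) : SB p F :=
  ⟨fun z => if z.res N = k % p ^ N then 1 else 0, N, fun y z h => by simp only [h]⟩

variable {F}

/-- The Fourier-Stieltjes transform `t ↦ ∫ e^{-2πi{tz}_p} dμ(z)`, with `e^{-2πi{tz}_p}` expanded as
`∑_{k<pᴺ} e^{-2πikt} [z ≡ k mod pᴺ]`, where `pᴺ = |t|_p`. -/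
def fourierStieltjes {L : Type*} [Field L] [Algebra F L] (e : AddChar (Zhat p) L)
    (μ : Distribution p F) (t : Zhat p) : L :=
  ∑ k ∈ Finset.range (p ^ Zhat.level t),
    algebraMap F L (μ (SB.indicator F (Zhat.level t) k)) * e (-(k • t))

end Distributions

/-! ### Polynomial algebras on symbols -/

section Polynomials

variable {d : ℕ} (k : Type*) [Field k] {V : Type*} [AddCommGroup V] [Module k V]

/-- The `k`-linear map from `k[x_1, …, x_d]` to `V` that sends the monomial `xⁿ` to `v n`. -/
def realize (v : (Fin d → ℕ) → V) : MvPolynomial (Fin d) k →ₗ[k] V :=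
  (MvPolynomial.basisMonomials (Fin d) k).constr k (fun n => v n)

/-- A bilinear product on the span of the `v n`, `n ∈ ℕ^d`, with `v m · v n = v (m + n)`. There is at
most one. -/
def IsFormalProduct (v : (Fin d → ℕ) → V)
    (mul : Submodule.span k (Set.range v) →ₗ[k] Submodule.span k (Set.range v) →ₗ[k]
      Submodule.span k (Set.range v)) : Prop :=
  ∀ m n : Fin d → ℕ,
    mul ⟨v m, Submodule.subset_span ⟨m, rfl⟩⟩ ⟨v n, Submodule.subset_span ⟨n, rfl⟩⟩ =
      ⟨v (m + n), Submodule.subset_span ⟨m + n, rfl⟩⟩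

/-- The value of a polynomial with coefficients in `k ⊆ F` at a point of a completion of `F`. -/
def evalCompl {F : Type*} [Field F] [Algebra k F] (w : AbsoluteValue F ℝ)
    (x : Fin d → UniformSpace.Completion (WithAbs w)) (P : MvPolynomial (Fin d) k) :
    UniformSpace.Completion (WithAbs w) :=
  MvPolynomial.eval₂ (UniformSpace.Completion.coeRingHom.comp
    ((WithAbs.equiv w).symm.toRingHom.comp (algebraMap k F))) x P

end Polynomials

section Algebraic

variable {d p : ℕ} [NeZero p] {E : Set (Zp p)} {A : Type*} [CommRing A] (k : Type*) [Field k]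
  (F : Type*) [Field F] [Algebra A F] [Algebra k F]

/-- `f̂` is a Fourier transform of the function `P(X_1, …, X_d)`, for compatible functions `X_j` and a
polynomial `P` with coefficients in `k ⊆ F`. -/
def IsFourierTransformOfPolynomial {L : Type*} [Field L] [Algebra F L] (G : Frame E A)
    (e : AddChar (Zhat p) L) (fh : Zhat p → L) (X : Fin d → G.Compat)
    (P : MvPolynomial (Fin d) k) : Prop :=
  ∀ z : E, ∃ w : AbsoluteValue F ℝ, Extends (G.abv z) w ∧
    FourierSeriesTendsto e fh z.1 w (evalCompl k w (fun j => fracMap (G.abv z) w (X j z)) P)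

/-- The functions `X_1, …, X_d` are algebraically independent over `k`: only the zero polynomial `P`
has `P(X_1(z), …, X_d(z)) = 0` for all `z` in the domain. -/
def FunctionsAlgIndependent (G : Frame E A) (X : Fin d → G.Compat) : Prop :=
  ∀ P : MvPolynomial (Fin d) k,
    (∀ (z : E) (w : AbsoluteValue F ℝ), Extends (G.abv z) w →
      evalCompl k w (fun j => fracMap (G.abv z) w (X j z)) P = 0) → P = 0

end Algebraic

/-! ### The rings of parameters -/

/-- `O` is the ring of integers of the global field `K`: either `K` is a number field and `O` is the
integral closure of `ℤ`, or `K` has positive characteristic, is a finite extension of the field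
`𝔽_q(t)` of rational functions over its prime field, and `O` is the integral closure of `𝔽_q[t]`, for
some choice of `t`. -/
def IsGlobalFieldWithIntegers (K : Type*) [Field K] (O : Subring K) : Prop :=
  (NumberField K ∧ ∀ x : K, x ∈ O ↔ IsIntegral ℤ x) ∨
    (ringChar K ≠ 0 ∧ ∃ t : K, Transcendental (⊥ : Subfield K) t ∧
      FiniteDimensional (Subfield.closure {t}) K ∧
      ∀ x : K, x ∈ O ↔ IsIntegral (Subring.closure {t}) x)

section Rings

variable (d p : ℕ) (O : Type*) [CommRing O]

/-- The polynomial ring `R_d` over `O` in the `2dp` indeterminates `a_{j,k}`, `b_{j,k}`. -/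
abbrev ParamRing : Type _ := MvPolynomial ((Fin d × Fin p) ⊕ (Fin d × Fin p)) O

variable {d p}

/-- The indeterminate `a_{j,k}`. -/
def parA (j : Fin d) (k : Fin p) : ParamRing d p O := MvPolynomial.X (Sum.inl (j, k))

/-- The indeterminate `b_{j,k}`. -/
def parB (j : Fin d) (k : Fin p) : ParamRing d p O := MvPolynomial.X (Sum.inr (j, k))

variable (d p) [NeZero p]

/-- The ideal `⟨(1 - a_{1,0}) x_1 - 1, …, (1 - a_{d,0}) x_d - 1⟩` of `R_d[x_1, …, x_d]`. -/
def locIdeal : Ideal (MvPolynomial (Fin d) (ParamRing d p O)) :=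
  Ideal.span (Set.range fun j : Fin d =>
    MvPolynomial.C (1 - parA O j (0 : Fin p)) * MvPolynomial.X j - 1)

/-- The localization `R_d[x_1, …, x_d] / ⟨(1 - a_{j,0}) x_j - 1⟩`, in which the `1 - a_{j,0}` become
invertible. -/
def LocRing : Type _ := MvPolynomial (Fin d) (ParamRing d p O) ⧸ locIdeal d p O

instance : CommRing (LocRing d p O) :=
  inferInstanceAs (CommRing (MvPolynomial (Fin d) (ParamRing d p O) ⧸ locIdeal d p O))

instance : Algebra (ParamRing d p O) (LocRing d p O) :=
  inferInstanceAs (Algebra (ParamRing d p O)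
    (MvPolynomial (Fin d) (ParamRing d p O) ⧸ locIdeal d p O))

variable {d p O}

/-- The ideal that an ideal `I` of `R_d` generates in the localization. -/
abbrev extendedIdeal (I : Ideal (ParamRing d p O)) : Ideal (LocRing d p O) :=
  I.map (algebraMap (ParamRing d p O) (LocRing d p O))

/-- The quotient of the localization by the ideal generated by `I`. -/
abbrev QuotRing (I : Ideal (ParamRing d p O)) : Type _ := LocRing d p O ⧸ extendedIdeal I

/-- The image of an element of `R_d` in the quotient. -/
def toQuot (I : Ideal (ParamRing d p O)) (r : ParamRing d p O) : QuotRing I :=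
  Ideal.Quotient.mk (extendedIdeal I) (algebraMap (ParamRing d p O) (LocRing d p O) r)

/-- The image of `a_{j,k}` in the quotient. -/
def quotA (I : Ideal (ParamRing d p O)) (j : Fin d) (k : Fin p) : QuotRing I :=
  toQuot I (parA O j k)

/-- The image of `b_{j,k}` in the quotient. -/
def quotB (I : Ideal (ParamRing d p O)) (j : Fin d) (k : Fin p) : QuotRing I :=
  toQuot I (parB O j k)

end Rings

/-- The images in `L` of a family of elements of `A`, for `A → F → L`. -/
def inExt {d p : ℕ} {A : Type*} [CommRing A] (F : Type*) [Field F] [Algebra A F] (L : Type*) [Field L]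
    [Algebra F L] (c : Fin d → Fin p → A) (j : Fin d) (k : Fin p) : L :=
  algebraMap F L (algebraMap A F (c j k))

end FSeries

end

universe u

open Filter Topology

noncomputable section

/-! Iterating the functional equation over the first N digits of z gives x ↦ P_N x + S_N, where P_N
is `Zp.digitProd` and S_N is `Zp.digitSum`. The root condition forces |P_N| ≤ ρ^N eventually, for
some ρ < 1 (`Frame.RootCondition.eventually_le`). So S_N converges, and its limit is the only
possible value of a rising-continuous solution.

On the dual side, precomposing with t ↦ pt and multiplying by (1/p) ∑ c_k e(-kt) corresponds to
passing from z to θ_p(z) with the weight c of the lowest digit (`partialSum_shift`). The X̂_n solve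
the dual of the functional equation of X_n up to a multiple of Â_n, the defect, which can be nonzero
only in the resonant case α_n(0) = 1 (`IsFourierFamily.selfSimilar`). Hence the N-th partial sum has
a closed form (`IsFourierFamily.partialSum_eq`): the functional x^m ↦ X̂_m(0) applied to ∏_j (P_N
x_j + S_N)^{n_j}, plus N terms with the defects instead of X̂_m(0) and S_i, i < N, instead of S_N.
Since P_N → 0, only m = 0 survives in the first part, which tends to ∏_j X_j^{n_j}. The defect of
index 0 vanishes, so each of the other N terms carries a factor P_N, and N ρ^N → 0
(`tendsto_affineEval`). The closed form involves the X̂_m only through t = 0, where no root of unity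
appears, so the partial sums lie in F.

The partial sums are consistent under refinement of cosets, hence they are the densities of a
distribution (`exists_fourierStieltjes_eq`); finite Fourier inversion makes the transform injective.
The algebraic statements follow by linearity: a polynomial with zero realization has the zero
Fourier series, so it vanishes on the X_j. When I = 0, independence is already visible at z = 0,
after specializing all a_{j,k} to 0 and b_{j,0} to a variable. -/

namespace FSeries

/-! ### Digit expansions, and products and sums along the digits. -/

namespace Zp

variable {p : ℕ}

theorem res_zero (z : Zp p) : z.res 0 = 0 := by
  have := (z.2 0).1
  simpa [res] using this

theorem ext_res {y z : Zp p} (h : ∀ N, y.res N = z.res N) : y = z :=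
  Subtype.ext (funext h)

variable [NeZero p]

theorem res_succ (z : Zp p) (N : ℕ) : z.res (N + 1) = z.digit + p * z.shift.res N := by
  have h : z.res (N + 1) % p = z.digit := by
    have := z.res_mod (show 1 ≤ N + 1 by omega)
    rwa [pow_one] at this
  rw [← h]
  exact (Nat.mod_add_div _ _).symm

theorem res_ofNat (m N : ℕ) : (ofNat p m).res N = m % p ^ N := rfl

theorem digit_ofNat (m : ℕ) : ((ofNat p m).digit : ℕ) = m % p := by
  simp [digit, res_ofNat]

theorem shift_ofNat (m : ℕ) : (ofNat p m).shift = ofNat p (m / p) := by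
  refine ext_res fun N => ?_
  change m % p ^ (N + 1) / p = m / p % p ^ N
  rw [pow_succ', Nat.mod_mul_right_div_self]

theorem ofNat_res (z : Zp p) {M N : ℕ} (h : M ≤ N) : (ofNat p (z.res N)).res M = z.res M :=
  z.res_mod h

/-- The product `∏_{i<N} c(z_i)` over the first `N` digits of `z`. -/
def digitProd {R : Type*} [CommSemiring R] (c : Fin p → R) (z : Zp p) (N : ℕ) : R :=
  ∏ i ∈ Finset.range N, c (shift^[i] z).digit

/-- The sum `∑_{i<N} (∏_{h<i} a(z_h)) b(z_i)`. -/
def digitSum {R : Type*} [CommSemiring R] (a b : Fin p → R) (z : Zp p) (N : ℕ) : R :=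
  ∑ i ∈ Finset.range N, digitProd a z i * b (shift^[i] z).digit

section Digit

variable {R S : Type*} [CommSemiring R] [CommSemiring S]

@[simp] theorem digitProd_zero (c : Fin p → R) (z : Zp p) : digitProd c z 0 = 1 := rfl

@[simp] theorem digitSum_zero (a b : Fin p → R) (z : Zp p) : digitSum a b z 0 = 0 := rfl

theorem digitProd_succ (c : Fin p → R) (z : Zp p) (N : ℕ) :
    digitProd c z (N + 1) = c z.digit * digitProd c z.shift N := by
  simp [digitProd, Finset.prod_range_succ', mul_comm]

/-- The lowest digit is peeled off, not the highest one, so that the recursion has the shape of the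
functional equation; inductions on the length therefore vary `z`. -/
theorem digitSum_succ (a b : Fin p → R) (z : Zp p) (N : ℕ) :
    digitSum a b z (N + 1) = a z.digit * digitSum a b z.shift N + b z.digit := by
  simp [digitSum, Finset.sum_range_succ', digitProd_succ, Finset.mul_sum, mul_assoc]

theorem map_digitProd (f : R →+* S) (c : Fin p → R) (z : Zp p) (N : ℕ) :
    f (digitProd c z N) = digitProd (fun k => f (c k)) z N := by
  simp [digitProd]

theorem map_digitSum (f : R →+* S) (a b : Fin p → R) (z : Zp p) (N : ℕ) :
    f (digitSum a b z N) = digitSum (fun k => f (a k)) (fun k => f (b k)) z N := by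
  simp [digitSum, map_digitProd]

end Digit

end Zp

/-! ### The dual group: levels and fractions. -/

namespace Zhat

variable {p : ℕ}

theorem level_mem (t : Zhat p) : p ^ level t • t = 0 := by
  obtain ⟨n, hn⟩ := t.2
  exact Nat.sInf_mem (s := {n : ℕ | p ^ n • t = 0}) ⟨n, Subtype.ext hn⟩

theorem level_le_iff {t : Zhat p} {N : ℕ} : level t ≤ N ↔ p ^ N • t = 0 := by
  refine ⟨fun h => ?_, fun h => Nat.sInf_le h⟩
  rw [← Nat.sub_add_cancel h, pow_add, mul_smul, level_mem, smul_zero]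

theorem level_eq_zero {t : Zhat p} : level t = 0 ↔ t = 0 := by
  rw [← Nat.le_zero, level_le_iff]; simp

@[simp] theorem level_zero : level (0 : Zhat p) = 0 := level_eq_zero.2 rfl

theorem level_smul (t : Zhat p) : level (p • t) = level t - 1 := by
  refine eq_of_forall_ge_iff fun N => ?_
  rw [level_le_iff, ← mul_smul, ← pow_succ, ← level_le_iff]
  omega

/-- The residue matters only modulo `p ^ level t`, which kills `t`. Thus all characters in one
partial sum can be written with the same residue of `z`. -/
theorem pairing_eq {t : Zhat p} {N : ℕ} (h : level t ≤ N) (z : Zp p) :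
    pairing t z = z.res N • t := by
  rw [pairing, ← z.res_mod h]
  conv_rhs => rw [← Nat.mod_add_div (z.res N) (p ^ level t)]
  rw [add_smul, mul_comm, mul_smul, level_mem, smul_zero, add_zero]

variable [NeZero p]

theorem frac_eq_smul (N k : ℕ) : frac p N k = k • frac p N 1 := by
  refine Subtype.ext ?_
  change ((((k : ℚ) / (p : ℚ) ^ N : ℚ)) : AddCircle (1 : ℚ)) =
    ((k • frac p N 1 : Zhat p) : AddCircle (1 : ℚ))
  rw [AddSubgroup.coe_nsmul]
  change _ = k • ((((1 : ℕ) : ℚ) / (p : ℚ) ^ N : ℚ) : AddCircle (1 : ℚ))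
  rw [← AddCircle.coe_nsmul]
  congr 1
  simp [div_eq_mul_inv]

theorem smul_frac_succ (N k : ℕ) : p • frac p (N + 1) k = frac p N k := by
  have hp : (p : ℚ) ≠ 0 := Nat.cast_ne_zero.2 (NeZero.ne p)
  refine Subtype.ext ?_
  rw [AddSubgroup.coe_nsmul]
  change p • ((((k : ℕ) : ℚ) / (p : ℚ) ^ (N + 1) : ℚ) : AddCircle (1 : ℚ)) =
    (((k : ℕ) : ℚ) / (p : ℚ) ^ N : ℚ)
  rw [← AddCircle.coe_nsmul]
  congr 1
  simp only [nsmul_eq_mul]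
  field_simp
  ring

theorem frac_mul_left (N k : ℕ) : frac p (N + 1) (p * k) = frac p N k := by
  rw [frac_eq_smul, mul_smul, smul_comm, smul_frac_succ, ← frac_eq_smul]

/-- The class of `1 / p ^ N` has exact order `p ^ N`; every orthogonality relation below rests on
this. -/
theorem zsmul_frac_eq_zero_iff (N : ℕ) (c : ℤ) : c • frac p N 1 = 0 ↔ (p : ℤ) ^ N ∣ c := by
  have hp : (p : ℚ) ≠ 0 := Nat.cast_ne_zero.2 (NeZero.ne p)
  rw [← Subtype.coe_inj, AddSubgroup.coe_zsmul]
  change c • ((((1 : ℕ) : ℚ) / (p : ℚ) ^ N : ℚ) : AddCircle (1 : ℚ)) = 0 ↔ _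
  rw [← AddCircle.coe_zsmul, AddCircle.coe_eq_zero_iff]
  refine exists_congr fun k => ?_
  simp only [zsmul_eq_mul, mul_one, Nat.cast_one]
  rw [mul_one_div, eq_div_iff (pow_ne_zero _ hp), eq_comm, mul_comm]
  exact_mod_cast Iff.rfl

theorem smul_frac_self (N k : ℕ) : p ^ N • frac p N k = 0 := by
  rw [frac_eq_smul, smul_comm, ← natCast_zsmul (frac p N 1),
    (zsmul_frac_eq_zero_iff N _).2 (by simp), smul_zero]

theorem level_frac_le (N k : ℕ) : level (frac p N k) ≤ N :=
  level_le_iff.2 (smul_frac_self N k)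

/-- Lift `t` to a rational number: `p ^ N` times the lift is an integer `c`, and the remainder of
`c` modulo `p ^ N` is the numerator sought. -/
theorem exists_frac {t : Zhat p} {N : ℕ} (h : level t ≤ N) : ∃ k < p ^ N, t = frac p N k := by
  have hp : (p : ℚ) ^ N ≠ 0 := pow_ne_zero _ (Nat.cast_ne_zero.2 (NeZero.ne p))
  have hp0 : 0 < p ^ N := pow_pos (NeZero.pos p) N
  obtain ⟨q, hq⟩ := QuotientAddGroup.mk_surjective (t : AddCircle (1 : ℚ))
  have h1 : p ^ N • (t : AddCircle (1 : ℚ)) = 0 := by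
    have := congrArg (Subtype.val) (level_le_iff.1 h)
    simpa using this
  rw [← hq] at h1
  change p ^ N • ((q : ℚ) : AddCircle (1 : ℚ)) = 0 at h1
  rw [← AddCircle.coe_nsmul, AddCircle.coe_eq_zero_iff] at h1
  obtain ⟨c, hc⟩ := h1
  have hqc : q = c • (((1 : ℕ) : ℚ) / (p : ℚ) ^ N) := by
    simp only [zsmul_eq_mul, mul_one, nsmul_eq_mul, Nat.cast_pow, Nat.cast_one] at hc ⊢
    rw [hc]; field_simp
  have ht : t = c • frac p N 1 := by
    refine Subtype.ext ?_
    rw [← hq, AddSubgroup.coe_zsmul, hqc]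
    rfl
  refine ⟨(c % (p ^ N : ℕ)).toNat, ?_, ?_⟩
  · have := Int.emod_lt_of_pos c (show (0 : ℤ) < (p ^ N : ℕ) by exact_mod_cast hp0)
    omega
  · have h0 := Int.emod_nonneg c (show ((p ^ N : ℕ) : ℤ) ≠ 0 by exact_mod_cast hp0.ne')
    rw [frac_eq_smul, ← natCast_zsmul (frac p N 1), Int.toNat_of_nonneg h0, ht, ← sub_eq_zero, ← sub_smul,
      zsmul_frac_eq_zero_iff]
    exact_mod_cast Int.dvd_self_sub_emod

end Zhat

/-! ### Orthogonality of characters and the dual of the shift. -/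

section Orthogonality

variable {p : ℕ} [NeZero p] {L : Type*} [Field L] (e : AddChar (Zhat p) L)

theorem partialSum_eq (fh : Zhat p → L) (z : Zp p) (N : ℕ) :
    partialSum e fh z N =
      ∑ k ∈ Finset.range (p ^ N), fh (Zhat.frac p N k) * e (z.res N • Zhat.frac p N k) :=
  Finset.sum_congr rfl fun k _ => by rw [Zhat.pairing_eq (Zhat.level_frac_le N k)]

theorem partialSum_zero (fh : Zhat p → L) (z : Zp p) : partialSum e fh z 0 = fh 0 := by
  have : Zhat.frac p 0 0 = 0 := by rw [Zhat.frac_eq_smul, zero_smul]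
  simp [partialSum_eq, this]

theorem partialSum_add (f g : Zhat p → L) (z : Zp p) (N : ℕ) :
    partialSum e (fun t => f t + g t) z N = partialSum e f z N + partialSum e g z N := by
  simp [partialSum, add_mul, Finset.sum_add_distrib]

theorem partialSum_const_mul (c : L) (f : Zhat p → L) (z : Zp p) (N : ℕ) :
    partialSum e (fun t => c * f t) z N = c * partialSum e f z N := by
  simp [partialSum, Finset.mul_sum, mul_assoc]

theorem partialSum_sum {ι : Type*} (s : Finset ι) (f : ι → Zhat p → L) (z : Zp p) (N : ℕ) :
    partialSum e (fun t => ∑ i ∈ s, f i t) z N = ∑ i ∈ s, partialSum e (f i) z N := by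
  simp only [partialSum, Finset.sum_mul]
  exact Finset.sum_comm

variable {e}

/-- A geometric sum whose ratio has `p ^ N`-th power 1; by injectivity of `e` the ratio is 1 only in
the divisible case. -/
theorem sum_char_frac (he : Function.Injective e) (N : ℕ) (c : ℤ) :
    ∑ k ∈ Finset.range (p ^ N), e (c • Zhat.frac p N k) =
      if (p : ℤ) ^ N ∣ c then (p : L) ^ N else 0 := by
  have h1 : ∀ k, e (c • Zhat.frac p N k) = e (c • Zhat.frac p N 1) ^ k := fun k => by
    rw [Zhat.frac_eq_smul, smul_comm, AddChar.map_nsmul_eq_pow]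
  rw [Finset.sum_congr rfl fun k _ => h1 k]
  split_ifs with h
  · simp [(Zhat.zsmul_frac_eq_zero_iff N c).2 h]
  · have h2 : e (c • Zhat.frac p N 1) ≠ 1 := fun h3 => by
      rw [← e.map_zero_eq_one] at h3
      exact h ((Zhat.zsmul_frac_eq_zero_iff N c).1 (he h3))
    rw [geom_sum_eq h2, ← AddChar.map_nsmul_eq_pow, smul_comm, Zhat.smul_frac_self, smul_zero,
      AddChar.map_zero_eq_one, sub_self, zero_div]

theorem sum_range_mul {M : Type*} [AddCommMonoid M] (m n : ℕ) (f : ℕ → M) :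
    ∑ k ∈ Finset.range (m * n), f k =
      ∑ q ∈ Finset.range m, ∑ s ∈ Finset.range n, f (q + m * s) := by
  rcases Nat.eq_zero_or_pos m with rfl | hm
  · simp
  rw [← Finset.sum_product']
  refine Finset.sum_nbij' (fun k => (k % m, k / m)) (fun x => x.1 + m * x.2) ?_ ?_ ?_ ?_ ?_
  · intro k hk
    simp only [Finset.mem_range, Finset.mem_product] at hk ⊢
    exact ⟨Nat.mod_lt _ hm, Nat.div_lt_of_lt_mul hk⟩
  · rintro ⟨q, s⟩ h
    simp only [Finset.mem_range, Finset.mem_product] at h ⊢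
    calc q + m * s < m + m * s := by omega
      _ = m * (s + 1) := by ring
      _ ≤ m * n := Nat.mul_le_mul_left _ h.2
  · intro k _
    exact Nat.mod_add_div k m
  · rintro ⟨q, s⟩ h
    simp only [Finset.mem_range, Finset.mem_product] at h
    simp [Nat.add_mul_div_left _ _ hm, Nat.div_eq_of_lt h.1, Nat.mod_eq_of_lt h.1]
  · intro k _
    rw [Nat.mod_add_div]

/-- This describes the fibres of `t ↦ p • t`: the summand with `s` is killed by `p`, so `s` runs
through the fibre over `frac p N q`. -/
theorem frac_add_mul (N q s : ℕ) :
    Zhat.frac p (N + 1) (q + p ^ N * s) = Zhat.frac p (N + 1) q + Zhat.frac p 1 s := by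
  have h : ∀ N, Zhat.frac p (N + 1) (p ^ N) = Zhat.frac p 1 1 := by
    intro N
    induction N with
    | zero => simp
    | succ N ih => rw [pow_succ', Zhat.frac_mul_left, ih]
  rw [Zhat.frac_eq_smul, add_smul, ← Zhat.frac_eq_smul, mul_comm, mul_smul, ← Zhat.frac_eq_smul, h,
    ← Zhat.frac_eq_smul]

/-- Group the `t` of level at most `N + 1` by `p • t`. On a fibre the factor of `h` is constant, and
the sum of characters keeps only the `k` equal to the lowest digit of `z`. What remains of the
character at `z` is the character at `z.shift`, one level down. -/
theorem partialSum_shift (he : Function.Injective e) (hp : (p : L) ≠ 0) (c : Fin p → L)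
    (h : Zhat p → L) (z : Zp p) (N : ℕ) :
    partialSum e (fun t => (1 / (p : L) * ∑ k : Fin p, c k * e (-((k : ℕ) • t))) * h (p • t)) z
      (N + 1) = c z.digit * partialSum e h z.shift N := by
  have key : ∀ (k : Fin p) (q : ℕ),
      ∑ s ∈ Finset.range p,
        e (((z.res (N + 1) : ℤ) - (k : ℕ)) • Zhat.frac p (N + 1) (q + p ^ N * s)) =
      if k = z.digit then (p : L) * e (z.shift.res N • Zhat.frac p N q) else 0 := by
    intro k q
    simp only [frac_add_mul, smul_add, AddChar.map_add_eq_mul]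
    rw [← Finset.mul_sum]
    have h1 := sum_char_frac he 1 ((z.res (N + 1) : ℤ) - (k : ℕ))
    simp only [pow_one] at h1
    rw [h1, z.res_succ]
    -- Modulo `p` the residue of `z` is its lowest digit, and `k` and the digit are both below `p`.
    have hdvd : (p : ℤ) ∣ ((z.digit + p * z.shift.res N : ℕ) : ℤ) - (k : ℕ) ↔ k = z.digit := by
      rw [← Int.modEq_iff_dvd, Int.natCast_modEq_iff, Fin.ext_iff]
      unfold Nat.ModEq
      rw [Nat.add_mul_mod_self_left, Nat.mod_eq_of_lt k.2, Nat.mod_eq_of_lt z.digit.2]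
    simp only [hdvd]
    split_ifs with hk
    · subst hk
      rw [mul_comm]
      congr 2
      push_cast
      rw [add_sub_cancel_left, mul_comm, mul_smul, natCast_zsmul, natCast_zsmul,
        Zhat.smul_frac_succ]
    · rw [mul_zero]
  have hfrac : ∀ q s, h (p • Zhat.frac p (N + 1) (q + p ^ N * s)) = h (Zhat.frac p N q) := by
    intro q s
    rw [frac_add_mul, smul_add, Zhat.smul_frac_succ]
    have := Zhat.smul_frac_self (p := p) 1 s
    rw [pow_one] at this
    rw [this, add_zero]
  rw [partialSum_eq, partialSum_eq, pow_succ, sum_range_mul, Finset.mul_sum]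
  refine Finset.sum_congr rfl fun q _ => ?_
  have hterm : ∀ s, (1 / (p : L) * ∑ k : Fin p,
      c k * e (-((k : ℕ) • Zhat.frac p (N + 1) (q + p ^ N * s)))) *
      h (p • Zhat.frac p (N + 1) (q + p ^ N * s)) *
      e (z.res (N + 1) • Zhat.frac p (N + 1) (q + p ^ N * s)) =
      ∑ k : Fin p, (1 / (p : L) * h (Zhat.frac p N q) * c k) *
        e (((z.res (N + 1) : ℤ) - (k : ℕ)) • Zhat.frac p (N + 1) (q + p ^ N * s)) := by
    intro s
    rw [hfrac, Finset.mul_sum, Finset.sum_mul, Finset.sum_mul]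
    refine Finset.sum_congr rfl fun k _ => ?_
    rw [sub_smul, natCast_zsmul, natCast_zsmul, sub_eq_add_neg, AddChar.map_add_eq_mul]
    ring
  simp only [hterm]
  rw [Finset.sum_comm]
  simp only [← Finset.mul_sum, key]
  simp only [mul_ite, mul_zero, Finset.sum_ite_eq', Finset.mem_univ, if_true]
  field_simp

end Orthogonality

/-! ### Multinomial expansion of products of affine forms. -/

section Binomial

variable {d : ℕ}

/-- The coefficient `∏_j binom(n_j, m_j) a_j^{m_j} b_j^{n_j - m_j}` of `x^m` in
`∏_j (a_j x_j + b_j)^{n_j}`. -/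
def binomCoeff {R : Type*} [CommSemiring R] (a b : Fin d → R) (m n : Fin d → ℕ) : R :=
  (∏ j, ((n j).choose (m j) : R)) * (∏ j, a j ^ m j) * ∏ j, b j ^ (n j - m j)

/-- The value at `∏_j (a_j x_j + b_j)^{n_j}` of the linear functional that sends `x^m` to `u m`. -/
def affineEval {R : Type*} [CommSemiring R] (a b : Fin d → R) (n : Fin d → ℕ)
    (u : (Fin d → ℕ) → R) : R :=
  ∑ m ∈ Finset.Iic n, binomCoeff a b m n * u m

theorem map_binomCoeff {R S : Type*} [CommSemiring R] [CommSemiring S] (f : R →+* S)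
    (a b : Fin d → R) (m n : Fin d → ℕ) :
    f (binomCoeff a b m n) = binomCoeff (fun j => f (a j)) (fun j => f (b j)) m n := by
  simp [binomCoeff]

theorem map_affineEval {R S : Type*} [CommSemiring R] [CommSemiring S] (f : R →+* S)
    (a b : Fin d → R) (n : Fin d → ℕ) (u : (Fin d → ℕ) → R) :
    f (affineEval a b n u) =
      affineEval (fun j => f (a j)) (fun j => f (b j)) n (fun m => f (u m)) := by
  simp [affineEval, map_binomCoeff]

theorem Iic_eq_piFinset (n : Fin d → ℕ) :
    Finset.Iic n = Fintype.piFinset fun j => Finset.range (n j + 1) := by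
  ext m
  simp [Pi.le_def]

theorem prod_affine_pow {R : Type*} [CommSemiring R] (a b y : Fin d → R) (n : Fin d → ℕ) :
    ∏ j, (a j * y j + b j) ^ n j = affineEval a b n (fun m => ∏ j, y j ^ m j) := by
  simp only [add_pow, affineEval, binomCoeff]
  rw [Finset.prod_univ_sum, Iic_eq_piFinset]
  refine Finset.sum_congr rfl fun m _ => ?_
  simp only [← Finset.prod_mul_distrib]
  exact Finset.prod_congr rfl fun j _ => by ring

theorem Iic_eq_insert_Iio (n : Fin d → ℕ) : Finset.Iic n = insert n (Finset.Iio n) := by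
  ext m
  simp [le_iff_eq_or_lt]

theorem sum_Iic {M : Type*} [AddCommMonoid M] (n : Fin d → ℕ) (f : (Fin d → ℕ) → M) :
    ∑ m ∈ Finset.Iic n, f m = f n + ∑ m ∈ Finset.Iio n, f m := by
  rw [Iic_eq_insert_Iio, Finset.sum_insert (by simp)]

theorem Iio_zero : Finset.Iio (0 : Fin d → ℕ) = ∅ := by
  ext m
  simp

theorem binomCoeff_self {R : Type*} [CommSemiring R] (a b : Fin d → R) (n : Fin d → ℕ) :
    binomCoeff a b n n = ∏ j, a j ^ n j := by
  simp [binomCoeff]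

/-- For `m < n` some exponent `n j - m j` is positive, so a zero translation kills the term. This is
the form taken by a newly created defect term. -/
theorem affineEval_zero_right {R : Type*} [CommSemiring R] (a : Fin d → R) (n : Fin d → ℕ)
    (u : (Fin d → ℕ) → R) : affineEval a (fun _ => 0) n u = (∏ j, a j ^ n j) * u n := by
  rw [affineEval, sum_Iic, binomCoeff_self, Finset.sum_eq_zero, add_zero]
  intro m hm
  obtain ⟨h1, j, hj⟩ := Pi.lt_def.1 (Finset.mem_Iio.1 hm)
  rw [binomCoeff, Finset.prod_eq_zero (f := fun j => (0 : R) ^ (n j - m j)) (Finset.mem_univ j),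
    mul_zero, zero_mul]
  exact zero_pow (by omega)

theorem realize_monomial (k : Type*) [Field k] {V : Type*} [AddCommGroup V] [Module k V]
    (v : (Fin d → ℕ) → V) (n : Fin d →₀ ℕ) (c : k) :
    realize k v (MvPolynomial.monomial n c) = c • v n := by
  have h : MvPolynomial.monomial n c = c • MvPolynomial.basisMonomials (Fin d) k n := by
    rw [MvPolynomial.coe_basisMonomials, MvPolynomial.smul_monomial, smul_eq_mul, mul_one]
  rw [h, map_smul, realize, Module.Basis.constr_basis]

theorem realize_prod_X (k : Type*) [Field k] {V : Type*} [AddCommGroup V] [Module k V]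
    (v : (Fin d → ℕ) → V) (n : Fin d → ℕ) :
    realize k v (∏ j, MvPolynomial.X j ^ n j) = v n := by
  have h : (∏ j, MvPolynomial.X j ^ n j : MvPolynomial (Fin d) k) =
      MvPolynomial.monomial (Finsupp.equivFunOnFinite.symm n) 1 := by
    rw [MvPolynomial.monomial_eq, Finsupp.prod_fintype _ _ (by simp)]
    simp
  rw [h, realize_monomial, one_smul]
  rfl

variable {L : Type*} [Field L]

theorem realize_affineEval (a b : Fin d → L) (n : Fin d → ℕ) (u : (Fin d → ℕ) → L)
    (Q : (Fin d → ℕ) → MvPolynomial (Fin d) L) :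
    realize L u (affineEval (fun j => MvPolynomial.C (a j)) (fun j => MvPolynomial.C (b j)) n Q) =
      affineEval a b n (fun m => realize L u (Q m)) := by
  rw [affineEval, map_sum]
  refine Finset.sum_congr rfl fun m _ => ?_
  rw [← map_binomCoeff MvPolynomial.C, ← MvPolynomial.smul_eq_C_mul, map_smul, smul_eq_mul]

/-- Reading the binomial sum as a linear functional on polynomials replaces identities between
multinomial coefficients by substitution of polynomials. -/
theorem affineEval_eq_realize (a b : Fin d → L) (n : Fin d → ℕ) (u : (Fin d → ℕ) → L) :
    affineEval a b n u = realize L u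
      (∏ j, (MvPolynomial.C (a j) * MvPolynomial.X j + MvPolynomial.C (b j)) ^ n j) := by
  rw [prod_affine_pow, realize_affineEval]
  simp only [realize_prod_X]

/-- Both sides apply the functional `x^m ↦ u m` to the same polynomial, since `a (A x + B) + b = (a
A) x + (a B + b)`. -/
theorem affineEval_comp (a b A B : Fin d → L) (n : Fin d → ℕ) (u : (Fin d → ℕ) → L) :
    affineEval a b n (fun m => affineEval A B m u) =
      affineEval (fun j => a j * A j) (fun j => a j * B j + b j) n u := by
  simp only [affineEval_eq_realize A B]
  rw [← realize_affineEval, ← prod_affine_pow, affineEval_eq_realize]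
  congr 1
  refine Finset.prod_congr rfl fun j _ => ?_
  simp only [MvPolynomial.C_mul, MvPolynomial.C_add]
  ring

theorem affineEval_add (a b : Fin d → L) (n : Fin d → ℕ) (u v : (Fin d → ℕ) → L) :
    affineEval a b n (fun m => u m + v m) = affineEval a b n u + affineEval a b n v := by
  simp [affineEval, mul_add, Finset.sum_add_distrib]

theorem affineEval_sum {ι : Type*} (s : Finset ι) (a b : Fin d → L) (n : Fin d → ℕ)
    (u : ι → (Fin d → ℕ) → L) :
    affineEval a b n (fun m => ∑ i ∈ s, u i m) = ∑ i ∈ s, affineEval a b n (u i) := by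
  simp only [affineEval, Finset.mul_sum]
  exact Finset.sum_comm

end Binomial

/-! ### The functions X̂_n: recursion, self-similarity, closed form of the partial sums. -/

section Family

variable {d p : ℕ} {L : Type*} [Field L] (e : AddChar (Zhat p) L) (a b : Fin d → Fin p → L)

/-- Only indices `m < n` enter. With the two lemmas that follow, this makes the well-founded
recursion meaningful and its solution unique. -/
theorem coeffC_congr {X Y : (Fin d → ℕ) → Zhat p → L} {n : Fin d → ℕ}
    (h : ∀ m < n, X m = Y m) : coeffC a b X n = coeffC a b Y n := by
  funext k
  rw [coeffC, coeffC]
  exact congrArg _ (Finset.sum_congr rfl fun m hm => by rw [h m (Finset.mem_Iio.1 hm)])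

theorem fhat_congr {X Y : (Fin d → ℕ) → Zhat p → L} {n : Fin d → ℕ}
    (h : ∀ m < n, X m = Y m) (t : Zhat p) : fhat e a b X n t = fhat e a b Y n t :=
  Finset.sum_congr rfl fun m hm => by rw [h m (Finset.mem_Iio.1 hm)]

theorem ghat_congr {X Y : (Fin d → ℕ) → Zhat p → L} {n : Fin d → ℕ}
    (h : ∀ m < n, X m = Y m) (t : Zhat p) : ghat e a b X n t = ghat e a b Y n t := by
  simp only [ghat, gammaAhat, beta, coeffC_congr a b h]

open Classical in
/-- The family `X̂_n`, defined by recursion on `n`. -/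
def fourierFamily : (Fin d → ℕ) → Zhat p → L :=
  (wellFounded_lt (α := Fin d → ℕ)).fix fun n ih =>
    if n = 0 then fun t => if t = 0 then 1 else 0
    else fun t => fhat e a b (fun m => if h : m < n then ih m h else 0) n t -
      ghat e a b (fun m => if h : m < n then ih m h else 0) n t

open Classical in
theorem isFourierFamily_fourierFamily : IsFourierFamily e a b (fourierFamily e a b) := by
  refine ⟨?_, fun n hn t => ?_⟩
  · rw [fourierFamily, WellFounded.fix_eq, if_pos rfl]
  · have h : ∀ m < n, (fun m => if h : m < n then fourierFamily e a b m else 0) m =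
        fourierFamily e a b m := fun m hm => dif_pos hm
    rw [← fhat_congr e a b h, ← ghat_congr e a b h]
    conv_lhs => rw [fourierFamily, WellFounded.fix_eq, if_neg hn]
    rfl

variable {e a b}

theorem IsFourierFamily.unique {X Y : (Fin d → ℕ) → Zhat p → L} (hX : IsFourierFamily e a b X)
    (hY : IsFourierFamily e a b Y) : X = Y := by
  funext n
  induction n using WellFoundedLT.induction with
  | ind n ih =>
    by_cases hn : n = 0
    · rw [hn, hX.1, hY.1]
    · funext t
      rw [hX.2 n hn, hY.2 n hn, fhat_congr e a b ih, ghat_congr e a b ih]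

variable (e a b)

open Classical in
/-- The constant `β_n(0)` if `α_n(0) = 1`, and `0` otherwise: the defect of `X̂_n` from being a
solution of the Fourier dual of the functional equation of `X_n`. -/
def defect (Xh : (Fin d → ℕ) → Zhat p → L) (n : Fin d → ℕ) : L :=
  if alpha e a b n n 0 = 1 then beta e a b Xh n 0 else 0

/-- Up to sign, β_n(t) is the contribution of the lower indices to the dual functional equation at a
point with `p • t = 0`; this is how ĝ_n corrects the lowest levels. -/
theorem beta_eq (Xh : (Fin d → ℕ) → Zhat p → L) (n : Fin d → ℕ) (t : Zhat p) :
    beta e a b Xh n t = -∑ m ∈ Finset.Iio n, alpha e a b m n t * Xh m 0 := by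
  simp only [beta, alpha, coeffC, neg_mul, Finset.sum_neg_distrib, Finset.mul_sum, Finset.sum_mul,
    mul_neg]
  rw [Finset.sum_comm]
  congr 1
  exact Finset.sum_congr rfl fun m _ => Finset.sum_congr rfl fun k _ => by ring

theorem defect_zero (Xh : (Fin d → ℕ) → Zhat p → L) : defect e a b Xh 0 = 0 := by
  simp [defect, beta_eq, Iio_zero]

theorem Ahat_zero (n : Fin d → ℕ) : Ahat e a b n 0 = 1 := by simp [Ahat]

/-- At `t = 0` this would say that α_n(0) = 1, whence the two cases in the definition of ĝ_n. -/
theorem Ahat_eq (n : Fin d → ℕ) {t : Zhat p} (ht : t ≠ 0) :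
    Ahat e a b n t = alpha e a b n n t * Ahat e a b n (p • t) := by
  obtain ⟨N, hN⟩ := Nat.exists_eq_succ_of_ne_zero (Zhat.level_eq_zero.not.2 ht)
  rw [Ahat, Ahat, Zhat.level_smul, hN, Nat.succ_eq_add_one, Nat.add_sub_cancel,
    Finset.prod_range_succ', pow_zero, one_smul, mul_comm]
  simp only [pow_succ, mul_smul]

/-- The term `i = 0` is split off, and a factor α_n(t) is common to the others. The recursion starts
at level 2 because the sum is empty below. -/
theorem fhat_eq (Xh : (Fin d → ℕ) → Zhat p → L) (n : Fin d → ℕ) {t : Zhat p} {N : ℕ}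
    (hN : Zhat.level t = N + 2) :
    fhat e a b Xh n t = ∑ m ∈ Finset.Iio n, alpha e a b m n t * Xh m (p • t) +
      alpha e a b n n t * fhat e a b Xh n (p • t) := by
  rw [fhat, fhat, Zhat.level_smul, hN, Finset.mul_sum, ← Finset.sum_add_distrib]
  refine Finset.sum_congr rfl fun m _ => ?_
  change ∑ i ∈ Finset.range (N + 1), _ = _ + _ * ∑ i ∈ Finset.range N, _
  rw [Finset.sum_range_succ', add_comm, Finset.mul_sum]
  congr 1
  · simp
  · refine Finset.sum_congr rfl fun i _ => ?_
    rw [Finset.prod_range_succ', pow_zero, one_smul]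
    simp only [pow_succ, mul_smul]
    ring

/-- β_n is evaluated at the same point of level one for `t` and for `p • t`; only the product gains
a factor. -/
theorem gammaAhat_succ (Xh : (Fin d → ℕ) → Zhat p → L) (n : Fin d → ℕ) {t : Zhat p} {N : ℕ}
    (hN : Zhat.level t = N + 2) :
    gammaAhat e a b Xh n t = alpha e a b n n t * gammaAhat e a b Xh n (p • t) := by
  rw [gammaAhat, gammaAhat, Zhat.level_smul, hN]
  change _ * ∏ i ∈ Finset.range (N + 1), _ = _ * (_ * ∏ i ∈ Finset.range N, _)
  rw [Finset.prod_range_succ', pow_zero, one_smul]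
  change beta e a b Xh n (p ^ (N + 1) • t) * _ = _ * (beta e a b Xh n (p ^ N • p • t) * _)
  simp only [pow_succ, mul_smul]
  ring

variable {e a b}

theorem coeffR_eq (m n : Fin d → ℕ) (k : Fin p) :
    coeffR a b m n k = binomCoeff (fun j => a j k) (fun j => b j k) m n := rfl

variable [NeZero p]

theorem sum_char_eq_zero (he : Function.Injective e) {t : Zhat p} (ht : Zhat.level t = 1) :
    ∑ k : Fin p, e (-((k : ℕ) • t)) = 0 := by
  obtain ⟨s, hs, rfl⟩ := Zhat.exists_frac ht.le
  have h := sum_char_frac he 1 (-(s : ℤ))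
  rw [if_neg, pow_one] at h
  · rw [← h, Finset.sum_range]
    refine Finset.sum_congr rfl fun k _ => congrArg e ?_
    rw [Zhat.frac_eq_smul 1 s, Zhat.frac_eq_smul 1 (k : ℕ), smul_comm, neg_smul, natCast_zsmul]
  · intro h2
    rw [← Zhat.zsmul_frac_eq_zero_iff, neg_smul, natCast_zsmul, neg_eq_zero,
      ← Zhat.frac_eq_smul] at h2
    rw [h2, Zhat.level_zero] at ht
    exact zero_ne_one ht

/-- The indicator of 0 is dual to the constant 1. At level one α_0 vanishes by orthogonality; at
higher levels both indicators vanish. -/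
theorem IsFourierFamily.eq_zero_index {Xh : (Fin d → ℕ) → Zhat p → L} (hX : IsFourierFamily e a b Xh)
    (he : Function.Injective e) (hp : (p : L) ≠ 0) (t : Zhat p) :
    Xh 0 t = alpha e a b 0 0 t * Xh 0 (p • t) := by
  have hα : ∀ t, alpha e a b 0 0 t = 1 / (p : L) * ∑ k : Fin p, e (-((k : ℕ) • t)) := by
    intro t
    simp [alpha, coeffR]
  rw [hX.1, hα]
  beta_reduce
  by_cases ht : t = 0
  · simp [ht, hp]
  · rw [if_neg ht]
    by_cases h1 : Zhat.level t = 1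
    · rw [sum_char_eq_zero he h1, mul_zero, zero_mul]
    · rw [if_neg, mul_zero]
      rw [← Zhat.level_eq_zero, Zhat.level_smul]
      rw [← Zhat.level_eq_zero] at ht
      omega

/-- From level 2 on f̂_n satisfies the inhomogeneous recursion and the terms of ĝ_n the homogeneous
one, except that the term linear in v_p(t) changes by β_n(0) Â_n(t) at each step. That change is the
defect. At the levels 0 and 1, where f̂_n vanishes, ĝ_n supplies the lower-index contribution
through β_n. -/
theorem IsFourierFamily.selfSimilar {Xh : (Fin d → ℕ) → Zhat p → L}
    (hX : IsFourierFamily e a b Xh) (he : Function.Injective e) (hp : (p : L) ≠ 0)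
    (n : Fin d → ℕ) (t : Zhat p) :
    Xh n t = ∑ m ∈ Finset.Iic n, alpha e a b m n t * Xh m (p • t) +
      defect e a b Xh n * Ahat e a b n t := by
  rw [sum_Iic]
  by_cases hn : n = 0
  · subst hn
    rw [defect_zero, Iio_zero, Finset.sum_empty, zero_mul, add_zero, add_zero]
    exact hX.eq_zero_index he hp t
  rw [hX.2 n hn, hX.2 n hn]
  -- The points `t = 0`, level 1 (where `p • t = 0`) and level at least 2 behave differently.
  rcases hN : Zhat.level t with _ | _ | N
  · obtain rfl := Zhat.level_eq_zero.1 hN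
    have hf : fhat e a b Xh n 0 = 0 := by simp [fhat]
    have hβ := beta_eq e a b Xh n 0
    rw [eq_neg_iff_add_eq_zero] at hβ
    simp only [smul_zero, hf, Ahat_zero, ghat, defect, if_true]
    split_ifs with h1
    · linear_combination -hβ
    · have h2 : 1 - alpha e a b n n 0 ≠ 0 := sub_ne_zero.2 (Ne.symm h1)
      field_simp
      linear_combination (alpha e a b n n 0 - 1) * hβ
  · have ht : t ≠ 0 := fun h => by simp [h] at hN
    have ht' : p • t = 0 := by rw [← Zhat.level_eq_zero, Zhat.level_smul, hN]
    have hf : fhat e a b Xh n 0 = 0 := by simp [fhat]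
    have hf' : fhat e a b Xh n t = 0 := by simp [fhat, hN]
    have hβ := beta_eq e a b Xh n t
    have hγ : gammaAhat e a b Xh n t = beta e a b Xh n t := by simp [gammaAhat, hN]
    have hA : Ahat e a b n t = alpha e a b n n t := by
      rw [Ahat_eq e a b n ht, ht', Ahat_zero, mul_one]
    simp only [ht', hf, hf', hA, ghat, defect, if_true, if_neg ht, hγ, hN]
    split_ifs with h1
    · push_cast
      linear_combination -hβ
    · linear_combination -hβ
  · have ht : t ≠ 0 := fun h => by simp [h] at hN
    have hL : Zhat.level (p • t) = N + 1 := by rw [Zhat.level_smul, hN]; rfl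
    have ht' : p • t ≠ 0 := fun h => by simp [h] at hL
    have hf := fhat_eq e a b Xh n hN
    have hγ := gammaAhat_succ e a b Xh n hN
    have hA := Ahat_eq e a b n ht
    simp only [ghat, defect, if_neg ht, if_neg ht', hγ, hf, hA, hN, hL]
    split_ifs with h1
    · push_cast
      ring
    · ring

/-- With α_n(0) = 1 the product recursion of Â_n also holds at 0, so `partialSum_shift` applies to
it at every point. -/
theorem partialSum_Ahat (he : Function.Injective e) (hp : (p : L) ≠ 0) {n : Fin d → ℕ}
    (h1 : alpha e a b n n 0 = 1) (z : Zp p) (N : ℕ) :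
    partialSum e (Ahat e a b n) z N = ∏ j, Zp.digitProd (a j) z N ^ n j := by
  induction N generalizing z with
  | zero => simp [partialSum_zero, Ahat_zero]
  | succ N ih =>
    have h2 : Ahat e a b n = fun t => alpha e a b n n t * Ahat e a b n (p • t) := by
      funext t
      by_cases ht : t = 0
      · rw [ht, smul_zero, h1, one_mul]
      · exact Ahat_eq e a b n ht
    rw [h2]
    unfold alpha
    rw [partialSum_shift he hp (coeffR a b n n), ih, coeffR_eq, binomCoeff_self,
      ← Finset.prod_mul_distrib]
    exact Finset.prod_congr rfl fun j _ => by rw [Zp.digitProd_succ, mul_pow]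

/-- Self-similarity and `partialSum_shift` apply one affine substitution per digit, and
`affineEval_comp` composes these. Each step also creates one defect term, which later steps
transport. -/
theorem IsFourierFamily.partialSum_eq {Xh : (Fin d → ℕ) → Zhat p → L}
    (hX : IsFourierFamily e a b Xh) (he : Function.Injective e) (hp : (p : L) ≠ 0)
    (n : Fin d → ℕ) (z : Zp p) (N : ℕ) :
    partialSum e (Xh n) z N =
      affineEval (fun j => Zp.digitProd (a j) z N) (fun j => Zp.digitSum (a j) (b j) z N) n
        (fun m => Xh m 0) +
      ∑ i ∈ Finset.range N, affineEval (fun j => Zp.digitProd (a j) z N)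
        (fun j => Zp.digitSum (a j) (b j) z i) n (defect e a b Xh) := by
  induction N generalizing z n with
  | zero => simp [partialSum_zero, affineEval_zero_right]
  | succ N ih =>
    have h1 : Xh n = fun t => ∑ m ∈ Finset.Iic n, alpha e a b m n t * Xh m (p • t) +
        defect e a b Xh n * Ahat e a b n t := funext fun t => hX.selfSimilar he hp n t
    -- The new defect term has the full product but an empty digit sum: it is the term `i = 0` of
    -- the second sum. Away from resonance it is zero on both sides.
    have h2 : defect e a b Xh n * partialSum e (Ahat e a b n) z (N + 1) =
        affineEval (fun j => Zp.digitProd (a j) z (N + 1))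
          (fun j => Zp.digitSum (a j) (b j) z 0) n (defect e a b Xh) := by
      simp only [Zp.digitSum_zero]
      rw [affineEval_zero_right, mul_comm]
      by_cases h3 : alpha e a b n n 0 = 1
      · rw [partialSum_Ahat he hp h3]
      · rw [defect, if_neg h3, mul_zero, mul_zero]
    have h4 : ∀ m, partialSum e (fun t => alpha e a b m n t * Xh m (p • t)) z (N + 1) =
        coeffR a b m n z.digit * partialSum e (Xh m) z.shift N :=
      fun m => partialSum_shift he hp (coeffR a b m n) (Xh m) z N
    conv_lhs => rw [h1]
    rw [partialSum_add, partialSum_const_mul, h2, partialSum_sum]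
    simp only [h4, ih, coeffR_eq]
    change affineEval (fun j => a j z.digit) (fun j => b j z.digit) n _ + _ = _
    rw [affineEval_add, affineEval_sum, affineEval_comp]
    simp only [affineEval_comp]
    rw [Finset.sum_range_succ']
    simp only [Zp.digitProd_succ, Zp.digitSum_succ]
    ring

end Family

/-! ### The partial sums lie in F. -/

section Descent

variable {d p : ℕ} {A : Type*} [CommRing A] (F : Type*) [Field F] [Algebra A F]
  {L : Type*} [Field L] [Algebra F L] {e : AddChar (Zhat p) L} {a b : Fin d → Fin p → A}

theorem inExt_mem (c : Fin d → Fin p → A) (j : Fin d) (k : Fin p) :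
    inExt F L c j k ∈ (algebraMap F L).fieldRange := ⟨_, rfl⟩

theorem coeffR_mem (m n : Fin d → ℕ) (k : Fin p) :
    coeffR (inExt F L a) (inExt F L b) m n k ∈ (algebraMap F L).fieldRange := by
  refine mul_mem (mul_mem (prod_mem fun j _ => natCast_mem _ _) (prod_mem fun j _ => ?_))
    (prod_mem fun j _ => ?_)
  · exact pow_mem (inExt_mem F a j k) _
  · exact pow_mem (inExt_mem F b j k) _

/-- At `t = 0` all characters are 1, so no root of unity is left. The same holds for β_n(0), X̂_n(0)
and the defects, the only values of L in the closed form that do not come from A. -/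
theorem alpha_zero_mem (m n : Fin d → ℕ) :
    alpha e (inExt F L a) (inExt F L b) m n 0 ∈ (algebraMap F L).fieldRange := by
  refine mul_mem (div_mem (one_mem _) (natCast_mem _ _)) (sum_mem fun k _ => ?_)
  rw [smul_zero, neg_zero, AddChar.map_zero_eq_one, mul_one]
  exact coeffR_mem F m n k

variable {Xh : (Fin d → ℕ) → Zhat p → L}

theorem beta_zero_mem {n : Fin d → ℕ} (h : ∀ m < n, Xh m 0 ∈ (algebraMap F L).fieldRange) :
    beta e (inExt F L a) (inExt F L b) Xh n 0 ∈ (algebraMap F L).fieldRange := by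
  rw [beta_eq]
  exact neg_mem (sum_mem fun m hm => mul_mem (alpha_zero_mem F m n) (h m (Finset.mem_Iio.1 hm)))

theorem IsFourierFamily.apply_zero_mem
    (hX : IsFourierFamily e (inExt F L a) (inExt F L b) Xh) (n : Fin d → ℕ) :
    Xh n 0 ∈ (algebraMap F L).fieldRange := by
  induction n using WellFoundedLT.induction with
  | ind n ih =>
    by_cases hn : n = 0
    · rw [hn, hX.1]
      simp only [if_true]
      exact one_mem _
    · rw [hX.2 n hn]
      have hf : fhat e (inExt F L a) (inExt F L b) Xh n 0 = 0 := by simp [fhat]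
      rw [hf, zero_sub]
      refine neg_mem ?_
      simp only [ghat, if_true]
      split_ifs
      · exact zero_mem _
      · exact div_mem (beta_zero_mem F ih) (sub_mem (one_mem _) (alpha_zero_mem F n n))

theorem IsFourierFamily.defect_mem
    (hX : IsFourierFamily e (inExt F L a) (inExt F L b) Xh) (n : Fin d → ℕ) :
    defect e (inExt F L a) (inExt F L b) Xh n ∈ (algebraMap F L).fieldRange := by
  rw [defect]
  split_ifs
  · exact beta_zero_mem F fun m _ => hX.apply_zero_mem F m
  · exact zero_mem _

variable [NeZero p]

/-- The partial sums of the series of `X̂_n` lie in `F`, and are given there by a closed formula. -/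
theorem IsFourierFamily.exists_partialSum_eq
    (hX : IsFourierFamily e (inExt F L a) (inExt F L b) Xh) (he : Function.Injective e)
    (hp : (p : L) ≠ 0) :
    ∃ u v : (Fin d → ℕ) → F, u 0 = 1 ∧ v 0 = 0 ∧ ∀ (n : Fin d → ℕ) (z : Zp p) (N : ℕ),
      algebraMap F L
        (affineEval (fun j => algebraMap A F (Zp.digitProd (a j) z N))
          (fun j => algebraMap A F (Zp.digitSum (a j) (b j) z N)) n u +
        ∑ i ∈ Finset.range N, affineEval (fun j => algebraMap A F (Zp.digitProd (a j) z N))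
          (fun j => algebraMap A F (Zp.digitSum (a j) (b j) z i)) n v) =
      partialSum e (Xh n) z N := by
  choose u hu using hX.apply_zero_mem F
  choose v hv using hX.defect_mem F
  refine ⟨u, v, ?_, ?_, fun n z N => ?_⟩
  · refine (algebraMap F L).injective ?_
    rw [hu, hX.1, map_one]
    simp
  · refine (algebraMap F L).injective ?_
    rw [hv, defect_zero, map_zero]
  · rw [hX.partialSum_eq he hp, map_add, map_sum]
    simp only [map_affineEval, Zp.map_digitProd, Zp.map_digitSum, hu, hv]
    rfl

end Descent

/-! ### Completions and the extension of absolute values to the field of fractions. -/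

section Completion

variable {R : Type*} [CommRing R]

/-- The canonical ring homomorphism to the completion for an absolute value. -/
def complHom (v : AbsoluteValue R ℝ) : R →+* UniformSpace.Completion (WithAbs v) :=
  UniformSpace.Completion.coeRingHom.comp (WithAbs.equiv v).symm.toRingHom

theorem norm_complHom (v : AbsoluteValue R ℝ) (r : R) : ‖complHom v r‖ = v r :=
  (UniformSpace.Completion.norm_coe (WithAbs.toAbs v r)).trans (WithAbs.norm_toAbs_eq v r)

theorem complHom_injective (v : AbsoluteValue R ℝ) : Function.Injective (complHom v) := by
  rw [injective_iff_map_eq_zero]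
  intro r hr
  rw [← v.eq_zero, ← norm_complHom, hr, norm_zero]

/-- Describing the cast through limits of sequences from `R` avoids computing with the transported
element. -/
theorem tendsto_completionCast {ι : Type*} {l : Filter ι} {v w : AbsoluteValue R ℝ} (h : v = w)
    {s : ι → R} {x : UniformSpace.Completion (WithAbs v)}
    (hs : Tendsto (fun i => complHom v (s i)) l (𝓝 x)) :
    Tendsto (fun i => complHom w (s i)) l (𝓝 (Frame.completionCast h x)) := by
  subst h
  exact hs

theorem isometry_map {S : Type*} [CommRing S] {v : AbsoluteValue R ℝ} {w : AbsoluteValue S ℝ}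
    (f : R →+* S) (h : ∀ r, w (f r) = v r) : Isometry (WithAbs.map v w f) :=
  AddMonoidHomClass.isometry_of_norm _ fun x => h x.ofAbs

/-- `UniformSpace.Completion.map` restricts to the given map on `R` because that map is uniformly
continuous; it is an isometry as `w` extends `v`. -/
theorem tendsto_fracMap {F : Type*} [Field F] [Algebra R F] {ι : Type*} {l : Filter ι}
    {v : AbsoluteValue R ℝ} {w : AbsoluteValue F ℝ} (h : Extends v w) {s : ι → R}
    {x : UniformSpace.Completion (WithAbs v)}
    (hs : Tendsto (fun i => complHom v (s i)) l (𝓝 x)) :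
    Tendsto (fun i => complHom w (algebraMap R F (s i))) l (𝓝 (fracMap v w x)) := by
  have hu := (isometry_map (v := v) (w := w) (algebraMap R F) h).uniformContinuous
  have h1 := ((UniformSpace.Completion.continuous_map
    (f := WithAbs.map v w (algebraMap R F))).tendsto x).comp hs
  refine h1.congr fun i => ?_
  exact UniformSpace.Completion.map_coe hu (WithAbs.toAbs v (s i))

theorem noZeroDivisors_of_absoluteValue (v : AbsoluteValue R ℝ) : NoZeroDivisors R where
  eq_zero_or_eq_zero_of_mul_eq_zero {a b} h := by
    have := congrArg v h
    simpa using this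

theorem fracMap_prod_pow {d : ℕ} {F : Type*} [Field F] [Algebra R F] {v : AbsoluteValue R ℝ}
    {w : AbsoluteValue F ℝ} (h : Extends v w) (x : Fin d → UniformSpace.Completion (WithAbs v))
    (n : Fin d → ℕ) : fracMap v w (∏ j, x j ^ n j) = ∏ j, fracMap v w (x j) ^ n j := by
  have hc := (isometry_map (v := v) (w := w) (algebraMap R F) h).continuous
  have h1 : ∀ y, fracMap v w y = UniformSpace.Completion.mapRingHom _ hc y := fun _ => rfl
  simp only [h1, map_prod, map_pow]

variable (F : Type*) [Field F] [Algebra R F] [IsFractionRing R F]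

/-- The value at a fraction is the quotient of the values. Chosen numerators and denominators
suffice, since cross-multiplication (`key`) shows independence of the representation. -/
theorem exists_extends (v : AbsoluteValue R ℝ) : ∃ w : AbsoluteValue F ℝ, Extends v w := by
  have := noZeroDivisors_of_absoluteValue v
  have hinj : Function.Injective (algebraMap R F) := IsFractionRing.injective R F
  have : Nontrivial R := (algebraMap R F).domain_nontrivial
  have hsec : ∀ x : F, ∃ a b : R, b ≠ 0 ∧ x = algebraMap R F a / algebraMap R F b := fun x => by
    obtain ⟨a, b, hb, h⟩ := IsFractionRing.div_surjective (A := R) x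
    exact ⟨a, b, nonZeroDivisors.ne_zero hb, h.symm⟩
  have hmap : ∀ {b : R}, b ≠ 0 → algebraMap R F b ≠ 0 := fun hb =>
    (map_ne_zero_iff _ hinj).2 hb
  choose num den hden hx using hsec
  have key : ∀ (a b : R), b ≠ 0 → ∀ x : F, x = algebraMap R F a / algebraMap R F b →
      v (num x) / v (den x) = v a / v b := by
    intro a b hb x hab
    have h1 := (hx x).symm.trans hab
    rw [div_eq_div_iff (hmap (hden x)) (hmap hb), ← map_mul, ← map_mul] at h1
    rw [div_eq_div_iff (v.ne_zero (hden x)) (v.ne_zero hb), ← map_mul, ← map_mul, hinj h1]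
  refine ⟨⟨⟨fun x => v (num x) / v (den x), fun x y => ?_⟩, fun x => ?_, fun x => ?_,
    fun x y => ?_⟩, fun r => ?_⟩
  · rw [key (num x * num y) (den x * den y) (mul_ne_zero (hden x) (hden y)), map_mul, map_mul,
      mul_div_mul_comm]
    rw [map_mul, map_mul, mul_div_mul_comm, ← hx, ← hx]
  · exact div_nonneg (v.nonneg _) (v.nonneg _)
  · change v (num x) / v (den x) = 0 ↔ _
    rw [div_eq_zero_iff, v.eq_zero, v.eq_zero, or_iff_left (hden x)]
    refine ⟨fun h => by rw [hx x, h, map_zero, zero_div], fun h => ?_⟩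
    have h1 := hx x
    rw [h, eq_comm, div_eq_zero_iff, or_iff_left (hmap (hden _))] at h1
    rw [h]
    exact (map_eq_zero_iff _ hinj).1 h1
  · change v (num (x + y)) / v (den (x + y)) ≤ v (num x) / v (den x) + v (num y) / v (den y)
    have h1 : x + y = algebraMap R F (num x * den y + den x * num y) /
        algebraMap R F (den x * den y) := by
      conv_lhs => rw [hx x, hx y, div_add_div _ _ (hmap (hden x)) (hmap (hden y))]
      simp only [map_mul, map_add]
    rw [key _ _ (mul_ne_zero (hden x) (hden y)) _ h1,
      div_add_div _ _ (v.ne_zero (hden x)) (v.ne_zero (hden y)), map_mul]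
    refine div_le_div_of_nonneg_right ?_ (mul_nonneg (v.nonneg _) (v.nonneg _))
    rw [← map_mul, ← map_mul]
    exact v.add_le _ _
  · change v (num _) / v (den _) = v r
    rw [key r 1 one_ne_zero _ (by simp)]
    have : v 1 = 1 := v.map_one
    rw [this, div_one]

end Completion

/-! ### From the root condition to geometric decay. -/

section RootCondition

variable {p : ℕ} [NeZero p]

/-- The digit 0 is excluded: `Nat.digits` does not record leading zeros, so their number depends on
`N`. -/
theorem digitCount_res_succ (hp : 2 ≤ p) (z : Zp p) (N : ℕ) {k : ℕ} (hk : k ≠ 0) :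
    digitCount p k (z.res (N + 1)) =
      (if (z.digit : ℕ) = k then 1 else 0) + digitCount p k (z.shift.res N) := by
  rw [z.res_succ, digitCount, digitCount]
  by_cases h : (z.digit : ℕ) ≠ 0 ∨ z.shift.res N ≠ 0
  · rw [Nat.digits_add p hp _ _ z.digit.2 h, List.count_cons, add_comm]
    simp
  · push Not at h
    simp [h.1, h.2, hk.symm]

/-- Take `a 0` as the default factor at all `N` places; each nonzero digit `k` then corrects it by
the ratio of `a k` to `a 0`. -/
theorem abv_digitProd_eq (hp : 2 ≤ p) {R : Type*} [CommRing R] (v : AbsoluteValue R ℝ)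
    (hv : v 1 = 1) {a : Fin p → R} (ha : v (a 0) ≠ 0) (z : Zp p) (N : ℕ) :
    v (Zp.digitProd a z N) = v (a 0) ^ N * ∏ k ∈ Finset.univ.erase (0 : Fin p),
      (v (a k) / v (a 0)) ^ digitCount p k (z.res N) := by
  induction N generalizing z with
  | zero => simp [Zp.res_zero, digitCount, hv]
  | succ N ih =>
    rw [Zp.digitProd_succ, map_mul, ih]
    have h1 : ∀ k ∈ Finset.univ.erase (0 : Fin p),
        (v (a k) / v (a 0)) ^ digitCount p k (z.res (N + 1)) =
        (if k = z.digit then v (a k) / v (a 0) else 1) *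
          (v (a k) / v (a 0)) ^ digitCount p k (z.shift.res N) := by
      intro k hk
      have hk0 : (k : ℕ) ≠ 0 := fun h => (Finset.mem_erase.1 hk).1 (Fin.ext h)
      rw [digitCount_res_succ hp z N hk0, pow_add]
      congr 1
      by_cases h : k = z.digit
      · simp [h]
      · rw [if_neg h, if_neg fun h' => h (Fin.ext h'.symm), pow_zero]
    rw [Finset.prod_congr rfl h1, Finset.prod_mul_distrib, Finset.prod_ite_eq']
    by_cases h0 : z.digit = 0
    · rw [h0, if_neg (by simp), pow_succ]
      ring
    · rw [if_pos (by simp [h0]), pow_succ]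
      field_simp

/-- The root condition makes the digit products decay geometrically. -/
theorem Frame.RootCondition.eventually_le (hp : 2 ≤ p) {E : Set (Zp p)} {R : Type*} [CommRing R]
    [Nontrivial R] {F : Frame E R} {a : Fin p → R} (h : F.RootCondition a) (ha : a 0 ≠ 0) (z : E) :
    ∃ ρ : ℝ, 0 ≤ ρ ∧ ρ < 1 ∧ ∀ᶠ N in atTop, F.abv z (Zp.digitProd a z.1 N) ≤ ρ ^ N := by
  set v := F.abv z with hv
  have := noZeroDivisors_of_absoluteValue v
  have hv1 : v 1 = 1 := v.map_one
  have hc : 0 < v (a 0) := v.pos ha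
  set u : ℕ → ℝ := fun n => ∏ k ∈ Finset.univ.erase (0 : Fin p),
    (v (a k) / v (a 0)) ^ digitCount p k (z.1.res n) with hu
  have hu0 : ∀ n, 0 ≤ u n := fun n =>
    Finset.prod_nonneg fun k _ => pow_nonneg (div_nonneg (v.nonneg _) hc.le) _
  have hprod : ∀ n, v (Zp.digitProd a z.1 n) = v (a 0) ^ n * u n := fun n =>
    abv_digitProd_eq hp v hv1 hc.ne' z.1 n
  have hroot : v (a 0) * limsup (fun n : ℕ => u n ^ (1 / (n : ℝ))) atTop < 1 := h z
  obtain ⟨M, hM⟩ : ∃ M, ∀ k, v (a k) ≤ M :=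
    ⟨∑ k, v (a k), fun k => Finset.single_le_sum (f := fun k => v (a k))
      (fun i _ => v.nonneg _) (Finset.mem_univ k)⟩
  have hbd : ∀ n, v (Zp.digitProd a z.1 n) ≤ M ^ n := by
    intro n
    rw [Zp.digitProd, map_prod]
    refine (Finset.prod_le_prod (fun i _ => v.nonneg _) fun i _ => hM _).trans ?_
    simp
  -- A real `limsup` is informative only for a bounded sequence. The crude bound `M` on all
  -- parameters provides boundedness.
  have hbdd : IsBoundedUnder (· ≤ ·) atTop fun n : ℕ => u n ^ (1 / (n : ℝ)) := by
    refine isBoundedUnder_of_eventually_le (a := M / v (a 0)) ?_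
    filter_upwards [eventually_ge_atTop 1] with n hn
    have h1 : u n ≤ (M / v (a 0)) ^ n := by
      rw [div_pow, le_div_iff₀ (pow_pos hc n), mul_comm, ← hprod]
      exact hbd n
    refine (Real.rpow_le_rpow (hu0 n) h1 (by positivity)).trans_eq ?_
    rw [one_div, Real.pow_rpow_inv_natCast (div_nonneg ((v.nonneg _).trans (hM 0)) hc.le)
      (by omega)]
  -- The rate will be `v (a 0) * s`, with `s` strictly between the limsup and `1 / v (a 0)`.
  obtain ⟨s, hs1, hs2⟩ := exists_between ((lt_div_iff₀' hc).2 hroot)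
  have hev := eventually_lt_of_limsup_lt hs1 hbdd
  have hs0 : 0 ≤ s := by
    obtain ⟨n, hn⟩ := hev.exists
    exact (Real.rpow_nonneg (hu0 n) _).trans hn.le
  refine ⟨v (a 0) * s, mul_nonneg hc.le hs0, by rwa [lt_div_iff₀' hc] at hs2, ?_⟩
  filter_upwards [hev, eventually_ge_atTop 1] with n hn h1
  rw [hprod, mul_pow]
  refine mul_le_mul_of_nonneg_left ?_ (pow_nonneg hc.le n)
  have h2 := pow_le_pow_left₀ (Real.rpow_nonneg (hu0 n) _) hn.le n
  rwa [one_div, Real.rpow_inv_natCast_pow (hu0 n) (by omega)] at h2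

/-- The function `g = 0` is admissible in the infimum, which is bounded below by 0. -/
theorem Frame.IsQuotient.abv_le {𝒳 : Type*} {D : Set 𝒳} {R : Type*} [CommRing R] {F : Frame D R}
    {J : Ideal R} {G : Frame D (R ⧸ J)} (h : F.IsQuotient J G) (x : D) (r : R) :
    G.abv x (Ideal.Quotient.mk J r) ≤ F.abv x r := by
  have h1 := h x fun _ => r
  simp only [seminorm] at h1
  rw [h1]
  refine (ciInf_le ⟨0, ?_⟩ (fun _ => (0 : J))).trans_eq ?_
  · rintro _ ⟨g, rfl⟩
    exact (F.abv x).nonneg _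
  · simp

end RootCondition

/-! ### Existence and uniqueness of rising-continuous solutions. -/

section Rising

variable {p : ℕ} [NeZero p] {A : Type*} [CommRing A]

/-- The sequence with `f(m) = a_{m mod p} f(⌊m/p⌋) + b_{m mod p}` for `m ≠ 0`, and given `f(0)`. -/
def natSolution (hp : 2 ≤ p) (a b : Fin p → A) (x : A) (m : ℕ) : A :=
  if h : m = 0 then x
  else
    have : m / p < m := Nat.div_lt_self (Nat.pos_of_ne_zero h) hp
    a (Zp.ofNat p m).digit * natSolution hp a b x (m / p) + b (Zp.ofNat p m).digit

theorem digit_ofNat_zero : (Zp.ofNat p 0).digit = 0 := Fin.ext (by simp [Zp.digit_ofNat])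

/-- At `m = 0` the recursion refers to itself, so the start value has to be a fixed point. -/
theorem natSolution_eq (hp : 2 ≤ p) {a b : Fin p → A} {x : A} (hx : x = a 0 * x + b 0) (m : ℕ) :
    natSolution hp a b x m =
      a (Zp.ofNat p m).digit * natSolution hp a b x (m / p) + b (Zp.ofNat p m).digit := by
  by_cases h : m = 0
  · subst h
    rw [Nat.zero_div, digit_ofNat_zero, natSolution, dif_pos rfl]
    exact hx
  · conv_lhs => rw [natSolution, dif_neg h]

theorem eq_digitProd_of_recursion {a b : Fin p → A} {f : ℕ → A}
    (hf : ∀ m, f m = a (Zp.ofNat p m).digit * f (m / p) + b (Zp.ofNat p m).digit)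
    (z : Zp p) (N : ℕ) :
    f (z.res N) = Zp.digitProd a z N * f 0 + Zp.digitSum a b z N := by
  induction N generalizing z with
  | zero => simp [Zp.res_zero]
  | succ N ih =>
    have h1 : (Zp.ofNat p (z.res (N + 1))).digit = z.digit := Fin.ext (z.ofNat_res (by omega))
    have h2 : z.res (N + 1) / p = z.shift.res N := rfl
    rw [hf, h1, h2, ih, Zp.digitProd_succ, Zp.digitSum_succ]
    ring

theorem eventually_res_ofNat (hp : 2 ≤ p) (m : ℕ) : ∀ᶠ N in atTop, (Zp.ofNat p m).res N = m := by
  filter_upwards [eventually_ge_atTop m] with N hN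
  exact Nat.mod_eq_of_lt ((Nat.lt_pow_self hp).trans_le (Nat.pow_le_pow_right (by omega) hN))

variable {E : Set (Zp p)} {G : Frame E A} {hG : G.IsReffinite} {a b : Fin p → A}

/-- At a non-negative integer the functional equation is an identity between elements of `A`, which
embeds in the completion; there the shift is `m ↦ m / p`. -/
theorem Frame.IsRisingSolution.exists_recursion (hp : 2 ≤ p) {X : G.Compat}
    (hX : G.IsRisingSolution hG a b X) :
    ∃ f : ℕ → A, (∀ m, X ⟨Zp.ofNat p m, hG.nat_mem m⟩ = complHom _ (f m)) ∧
      (∀ m, f m = a (Zp.ofNat p m).digit * f (m / p) + b (Zp.ofNat p m).digit) ∧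
      ∀ z : E, Tendsto (fun n => complHom (G.abv z) (f (z.1.res n))) atTop (𝓝 (X z)) := by
  obtain ⟨⟨f, hf, hlim⟩, heq⟩ := hX
  refine ⟨f, hf, fun m => ?_, hlim⟩
  have h1 := heq ⟨Zp.ofNat p m, hG.nat_mem m⟩
  set z : E := ⟨Zp.ofNat p m, hG.nat_mem m⟩ with hz
  set z' : E := ⟨z.1.shift, hG.shift_mem z.1 z.2⟩ with hz'
  -- The transported value at the shifted point is identified by uniqueness of limits: the
  -- truncations of `m / p` are eventually constant.
  have h2 := tendsto_completionCast (hG.abv_shift z) (hlim z')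
  have h3 : Tendsto (fun n => complHom (G.abv z) (f (z'.1.res n))) atTop
      (𝓝 (complHom (G.abv z) (f (m / p)))) := by
    refine tendsto_const_nhds.congr' ?_
    filter_upwards [eventually_res_ofNat hp (m / p)] with n hn
    have : z'.1 = Zp.ofNat p (m / p) := Zp.shift_ofNat m
    rw [this, hn]
  rw [tendsto_nhds_unique h2 h3, hf m] at h1
  refine complHom_injective (G.abv z) ?_
  rw [map_add, map_mul]
  exact h1

variable (G a) in
/-- The products of the parameters along the digits decay geometrically at all points of the
domain. -/
def Frame.HasDecay : Prop :=
  ∀ z : E, ∃ ρ : ℝ, 0 ≤ ρ ∧ ρ < 1 ∧ ∀ᶠ N in atTop, G.abv z (Zp.digitProd a z.1 N) ≤ ρ ^ N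

theorem Frame.HasDecay.tendsto_digitProd (h : G.HasDecay a) (z : E) :
    Tendsto (fun N => complHom (G.abv z) (Zp.digitProd a z.1 N)) atTop (𝓝 0) := by
  obtain ⟨ρ, h0, h1, h2⟩ := h z
  refine squeeze_zero_norm' ?_ (tendsto_pow_atTop_nhds_zero_of_lt_one h0 h1)
  filter_upwards [h2] with N hN
  rwa [norm_complHom]

/-- The series is dominated by a geometric one, since only finitely many values of `b` occur. -/
theorem Frame.HasDecay.exists_tendsto_digitSum (h : G.HasDecay a) (b : Fin p → A) (z : E) :
    ∃ x, Tendsto (fun N => complHom (G.abv z) (Zp.digitSum a b z.1 N)) atTop (𝓝 x) := by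
  obtain ⟨ρ, h0, h1, h2⟩ := h z
  set v := G.abv z
  have hM : ∀ k, v (b k) ≤ ∑ k, v (b k) := fun k =>
    Finset.single_le_sum (f := fun k => v (b k)) (fun i _ => v.nonneg _) (Finset.mem_univ k)
  have hs : Summable fun i => complHom v (Zp.digitProd a z.1 i * b (Zp.shift^[i] z.1).digit) := by
    refine Summable.of_norm_bounded_eventually_nat
      ((summable_geometric_of_lt_one h0 h1).mul_right (∑ k, v (b k))) ?_
    filter_upwards [h2] with i hi
    rw [norm_complHom, map_mul]
    exact mul_le_mul hi (hM _) (v.nonneg _) (pow_nonneg h0 i)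
  refine ⟨_, hs.hasSum.tendsto_sum_nat.congr fun N => ?_⟩
  rw [Zp.digitSum, map_sum]

/-- The start value `f 0` is multiplied by a digit product, which tends to 0, so it does not
influence the limit. -/
theorem tendsto_of_recursion (h : G.HasDecay a) {f : ℕ → A}
    (hf : ∀ m, f m = a (Zp.ofNat p m).digit * f (m / p) + b (Zp.ofNat p m).digit)
    {z : E} {x : G.Compl z} :
    Tendsto (fun n => complHom (G.abv z) (f (z.1.res n))) atTop (𝓝 x) ↔
      Tendsto (fun N => complHom (G.abv z) (Zp.digitSum a b z.1 N)) atTop (𝓝 x) := by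
  have h1 : Tendsto (fun N => complHom (G.abv z) (Zp.digitProd a z.1 N) *
      complHom (G.abv z) (f 0)) atTop (𝓝 0) := by
    simpa using (h.tendsto_digitProd z).mul_const (complHom (G.abv z) (f 0))
  have h2 : ∀ n, complHom (G.abv z) (f (z.1.res n)) =
      complHom (G.abv z) (Zp.digitProd a z.1 n) * complHom (G.abv z) (f 0) +
        complHom (G.abv z) (Zp.digitSum a b z.1 n) := fun n => by
    rw [eq_digitProd_of_recursion hf, map_add, map_mul]
  constructor
  · intro h3
    simpa [h2] using h3.sub h1
  · intro h3
    simpa [h2] using h1.add h3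

theorem Frame.IsRisingSolution.tendsto (hp : 2 ≤ p) (h : G.HasDecay a) {X : G.Compat}
    (hX : G.IsRisingSolution hG a b X) (z : E) :
    Tendsto (fun N => complHom (G.abv z) (Zp.digitSum a b z.1 N)) atTop (𝓝 (X z)) := by
  obtain ⟨f, -, hf, hlim⟩ := hX.exists_recursion hp
  exact (tendsto_of_recursion h hf).1 (hlim z)

/-- A geometrically decaying functional equation has a unique rising-continuous solution. -/
theorem Frame.HasDecay.existsUnique_isRisingSolution (hp : 2 ≤ p) (hG : G.IsReffinite)
    (h : G.HasDecay a) (b : Fin p → A) (hunit : IsUnit (1 - a 0)) :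
    ∃! X : G.Compat, G.IsRisingSolution hG a b X := by
  choose X hX using h.exists_tendsto_digitSum b
  refine ⟨X, ⟨?_, fun z => ?_⟩, fun Y hY => funext fun z =>
    tendsto_nhds_unique (hY.tendsto hp h z) (hX z)⟩
  -- With `c` inverse to `1 - a 0`, the start value `c * b 0` is the fixed point of `x ↦ a 0 * x + b
  -- 0`.
  · obtain ⟨c, hc⟩ := hunit.exists_right_inv
    have hf := natSolution_eq hp (a := a) (b := b) (x := c * b 0) (by linear_combination b 0 * hc)
    have hlim : ∀ z : E, Tendsto (fun n => complHom (G.abv z)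
        (natSolution hp a b (c * b 0) (z.1.res n))) atTop (𝓝 (X z)) := fun z =>
      (tendsto_of_recursion h hf).2 (hX z)
    refine ⟨_, fun m => ?_, hlim⟩
    refine tendsto_nhds_unique (hlim _) (tendsto_const_nhds.congr' ?_)
    filter_upwards [eventually_res_ofNat hp m] with n hn
    rw [hn]
    rfl
  · have h1 := tendsto_completionCast (hG.abv_shift z) (hX ⟨z.1.shift, hG.shift_mem z.1 z.2⟩)
    refine tendsto_nhds_unique ((tendsto_add_atTop_iff_nat 1).2 (hX z)) ?_
    have h2 := (h1.const_mul (complHom (G.abv z) (a z.1.digit))).add_const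
      (complHom (G.abv z) (b z.1.digit))
    refine h2.congr fun N => ?_
    rw [Zp.digitSum_succ, map_add, map_mul]

end Rising

/-! ### The limit of the closed form. -/

section Limit

variable {d : ℕ} {V : Type*} [NormedCommRing V]

theorem affineEval_zero_left {R : Type*} [CommSemiring R] (b : Fin d → R) (n : Fin d → ℕ)
    (u : (Fin d → ℕ) → R) : affineEval (fun _ => 0) b n u = (∏ j, b j ^ n j) * u 0 := by
  rw [affineEval, Finset.sum_eq_single 0]
  · simp [binomCoeff]
  · intro m _ hm
    obtain ⟨j, hj⟩ := Function.ne_iff.1 hm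
    rw [binomCoeff, Finset.prod_eq_zero (f := fun j => (0 : R) ^ m j) (Finset.mem_univ j)
      (zero_pow hj), mul_zero, zero_mul, zero_mul]
  · simp

theorem exists_prod_pow_eq {R : Type*} [CommSemiring R] {m : Fin d → ℕ} (hm : m ≠ 0) :
    ∃ (j : Fin d) (m' : Fin d → ℕ), ∀ x : Fin d → R, ∏ i, x i ^ m i = x j * ∏ i, x i ^ m' i := by
  obtain ⟨j, hj⟩ := Function.ne_iff.1 hm
  have hle : Pi.single j 1 ≤ m := fun i => by
    by_cases h : i = j
    · subst h
      simpa using Nat.one_le_iff_ne_zero.2 hj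
    · simp [h]
  obtain ⟨m', rfl⟩ := exists_add_of_le hle
  refine ⟨j, m', fun x => ?_⟩
  simp only [Pi.add_apply, pow_add, Finset.prod_mul_distrib]
  congr 1
  rw [Finset.prod_eq_single j (fun i _ h => by simp [h]) (by simp)]
  simp

/-- The analytic core of the convergence of the Fourier series. -/
theorem tendsto_affineEval {A B : Fin d → ℕ → V} {X : Fin d → V} {ρ : Fin d → ℝ}
    (h0 : ∀ j, 0 ≤ ρ j) (h1 : ∀ j, ρ j < 1) (hA : ∀ j, ∀ᶠ N in atTop, ‖A j N‖ ≤ ρ j ^ N)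
    (hB : ∀ j, Tendsto (B j) atTop (𝓝 (X j))) {u v : (Fin d → ℕ) → V} (hu : u 0 = 1) (hv : v 0 = 0)
    (n : Fin d → ℕ) :
    Tendsto (fun N => affineEval (fun j => A j N) (fun j => B j N) n u +
      ∑ i ∈ Finset.range N, affineEval (fun j => A j N) (fun j => B j i) n v) atTop
      (𝓝 (∏ j, X j ^ n j)) := by
  have hA0 : ∀ j, Tendsto (A j) atTop (𝓝 0) := fun j =>
    squeeze_zero_norm' (hA j) (tendsto_pow_atTop_nhds_zero_of_lt_one (h0 j) (h1 j))
  -- The second sum has `N` terms, so decay of `A j N` is not enough: it has to beat the factor `N`.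
  have hNA : ∀ j, Tendsto (fun N : ℕ => (N : ℝ) * ‖A j N‖) atTop (𝓝 0) := fun j => by
    refine squeeze_zero' (Eventually.of_forall fun N => by positivity) ?_
      (tendsto_self_mul_const_pow_of_lt_one (h0 j) (h1 j))
    filter_upwards [hA j] with N hN
    exact mul_le_mul_of_nonneg_left hN N.cast_nonneg
  have hfirst : Tendsto (fun N => affineEval (fun j => A j N) (fun j => B j N) n u) atTop
      (𝓝 (affineEval (fun _ => 0) X n u)) := by
    refine tendsto_finsetSum _ fun m _ => Tendsto.mul_const _ ?_
    exact (tendsto_const_nhds.mul (tendsto_finsetProd _ fun j _ => (hA0 j).pow _)).mul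
      (tendsto_finsetProd _ fun j _ => (hB j).pow _)
  -- The products of the `A j N` do not depend on `i`, so they leave the sum over `i`.
  have hswap : ∀ N, ∑ i ∈ Finset.range N, affineEval (fun j => A j N) (fun j => B j i) n v =
      ∑ m ∈ Finset.Iic n, ((∏ j, ((n j).choose (m j) : V)) * v m) *
        ((∏ j, A j N ^ m j) * ∑ i ∈ Finset.range N, ∏ j, B j i ^ (n j - m j)) := by
    intro N
    simp only [affineEval, Finset.mul_sum]
    rw [Finset.sum_comm]
    refine Finset.sum_congr rfl fun m _ => Finset.sum_congr rfl fun i _ => ?_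
    rw [binomCoeff]
    ring
  have hsecond : Tendsto (fun N => ∑ i ∈ Finset.range N,
      affineEval (fun j => A j N) (fun j => B j i) n v) atTop (𝓝 0) := by
    simp only [hswap]
    rw [← Finset.sum_const_zero (s := Finset.Iic n)]
    refine tendsto_finsetSum _ fun m _ => ?_
    -- For `m = 0` there is no decaying factor, and `v 0 = 0` is needed. Otherwise one factor `A j
    -- N` is split off to absorb the `N` bounded summands.
    by_cases hm : m = 0
    · subst hm
      simp [hv]
    obtain ⟨j, m', hm'⟩ := exists_prod_pow_eq (R := V) hm
    obtain ⟨K, hK⟩ := (tendsto_finsetProd Finset.univ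
      fun j _ => (hB j).pow (n j - m j)).norm.bddAbove_range
    have hK' : ∀ i, ‖∏ j, B j i ^ (n j - m j)‖ ≤ K := fun i => hK ⟨i, rfl⟩
    have h2 : Tendsto (fun N => A j N * ∑ i ∈ Finset.range N, ∏ j, B j i ^ (n j - m j)) atTop
        (𝓝 0) := by
      have h3 := (hNA j).mul_const K
      rw [zero_mul] at h3
      refine squeeze_zero_norm (fun N => ?_) h3
      refine (norm_mul_le _ _).trans ?_
      have h4 : ‖∑ i ∈ Finset.range N, ∏ j, B j i ^ (n j - m j)‖ ≤ N * K := by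
        refine (norm_sum_le_of_le _ fun i _ => hK' i).trans_eq ?_
        simp
      refine (mul_le_mul_of_nonneg_left h4 (norm_nonneg _)).trans_eq ?_
      ring
    have h5 := (h2.mul (tendsto_finsetProd Finset.univ fun i _ => (hA0 i).pow (m' i))).const_mul
      ((∏ j, ((n j).choose (m j) : V)) * v m)
    rw [zero_mul, mul_zero] at h5
    refine h5.congr fun N => ?_
    rw [hm' fun i => A i N]
    ring
  have h6 := hfirst.add hsecond
  rwa [affineEval_zero_left, hu, mul_one, add_zero] at h6

end Limit

/-! ### Convergence of the Fourier series in the frame. -/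

section FourierTransform

variable {d p : ℕ} [NeZero p] {E : Set (Zp p)} {A : Type*} [CommRing A] {G : Frame E A}
  (F : Type*) [Field F] [Algebra A F] {L : Type*} [Field L] [Algebra F L]
  {e : AddChar (Zhat p) L} {a b : Fin d → Fin p → A} {Xh : (Fin d → ℕ) → Zhat p → L}

/-- The Fourier series of `X̂_n` lies in `F`, and converges to `X_n` for the absolute values of the
frame. -/
theorem IsFourierFamily.exists_tendsto
    (hXh : IsFourierFamily e (inExt F L a) (inExt F L b) Xh) (he : Function.Injective e)
    (hp : (p : L) ≠ 0) (hdec : ∀ j, G.HasDecay (a j)) :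
    ∃ s : (Fin d → ℕ) → Zp p → ℕ → F,
      (∀ n z N, algebraMap F L (s n z N) = partialSum e (Xh n) z N) ∧
      ∀ X : Fin d → G.Compat,
        (∀ j z, Tendsto (fun N => complHom (G.abv z) (Zp.digitSum (a j) (b j) z.1 N)) atTop
          (𝓝 (X j z))) →
        ∀ (n : Fin d → ℕ) (z : E) (w : AbsoluteValue F ℝ), Extends (G.abv z) w →
          Tendsto (fun N => complHom w (s n z.1 N)) atTop
            (𝓝 (∏ j, fracMap (G.abv z) w (X j z) ^ n j)) := by
  obtain ⟨u, v, hu, hv, huv⟩ := hXh.exists_partialSum_eq F he hp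
  refine ⟨_, huv, fun X hX n z w hw => ?_⟩
  choose ρ h0 h1 hρ using fun j => hdec j z
  have key := tendsto_affineEval (V := UniformSpace.Completion (WithAbs w))
    (A := fun j N => complHom w (algebraMap A F (Zp.digitProd (a j) z.1 N)))
    (B := fun j N => complHom w (algebraMap A F (Zp.digitSum (a j) (b j) z.1 N)))
    h0 h1 (fun j => by
      filter_upwards [hρ j] with N hN
      rw [norm_complHom, hw]
      exact hN) (fun j => tendsto_fracMap hw (hX j z))
    (u := fun m => complHom w (u m)) (v := fun m => complHom w (v m))
    (by rw [hu, map_one]) (by rw [hv, map_zero]) n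
  refine key.congr fun N => ?_
  rw [map_add, map_sum]
  simp only [map_affineEval]

end FourierTransform

/-! ### Fourier-Stieltjes transforms: refinement, inversion, existence. -/

section Distributions

variable {p : ℕ} {F : Type*} [Field F]

theorem Zp.res_lt (z : Zp p) (N : ℕ) : z.res N < p ^ N := (z.2 N).1

theorem SB.indicator_apply (N k : ℕ) (z : Zp p) [Decidable (z.res N = k % p ^ N)] :
    (SB.indicator F N k : SB p F).1 z = if z.res N = k % p ^ N then 1 else 0 := by
  unfold SB.indicator
  dsimp only
  congr

variable [NeZero p]

theorem pow_pos_of_neZero (N : ℕ) : 0 < p ^ N := pow_pos (NeZero.pos p) N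

/-- A coset modulo `p ^ M` is the disjoint union of its subcosets modulo `p ^ N`; a point `z` lies
in the one with `s = z.res N / p ^ M`. -/
theorem SB.sum_indicator {M N q : ℕ} (h : M ≤ N) (hq : q < p ^ M) :
    ∑ s ∈ Finset.range (p ^ (N - M)), SB.indicator F N (q + p ^ M * s) =
      (SB.indicator F M q : SB p F) := by
  classical
  have hM := pow_pos_of_neZero (p := p) M
  have hN : p ^ N = p ^ M * p ^ (N - M) := by rw [← pow_add, Nat.add_sub_cancel' h]
  refine Subtype.ext (funext fun z => ?_)
  rw [AddSubmonoidClass.coe_finsetSum, Finset.sum_apply, SB.indicator_apply,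
    Nat.mod_eq_of_lt hq]
  have h1 : ∀ s ∈ Finset.range (p ^ (N - M)),
      (SB.indicator F N (q + p ^ M * s) : SB p F).1 z =
        if s = z.res N / p ^ M then (if z.res M = q then 1 else 0) else 0 := by
    intro s hs
    have hlt : q + p ^ M * s < p ^ N := by
      rw [hN]
      calc q + p ^ M * s < p ^ M + p ^ M * s := by omega
        _ = p ^ M * (s + 1) := by ring
        _ ≤ _ := Nat.mul_le_mul_left _ (Finset.mem_range.1 hs)
    rw [SB.indicator_apply, Nat.mod_eq_of_lt hlt, ← z.res_mod h, ← ite_and]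
    refine if_congr ?_ rfl rfl
    constructor
    · intro hz
      rw [hz, Nat.add_mul_div_left _ _ hM, Nat.div_eq_of_lt hq, Nat.add_mul_mod_self_left,
        Nat.mod_eq_of_lt hq]
      simp
    · rintro ⟨rfl, hz⟩
      rw [← hz, Nat.mod_add_div]
  rw [Finset.sum_congr rfl h1, Finset.sum_ite_eq', if_pos]
  rw [Finset.mem_range, Nat.div_lt_iff_lt_mul hM, mul_comm, ← hN]
  exact z.res_lt N

theorem SB.eq_sum_indicator {φ : SB p F} {N : ℕ}
    (h : ∀ y z : Zp p, y.res N = z.res N → φ.1 y = φ.1 z) :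
    φ = ∑ k ∈ Finset.range (p ^ N), φ.1 (Zp.ofNat p k) • SB.indicator F N k := by
  classical
  refine Subtype.ext (funext fun z => ?_)
  rw [AddSubmonoidClass.coe_finsetSum, Finset.sum_apply, Finset.sum_eq_single (z.res N)]
  · rw [Submodule.coe_smul, Pi.smul_apply, SB.indicator_apply, if_pos, smul_eq_mul, mul_one]
    · exact h _ _ (z.ofNat_res le_rfl).symm
    · exact (Nat.mod_eq_of_lt (z.res_lt N)).symm
  · intro k hk hne
    rw [Submodule.coe_smul, Pi.smul_apply, SB.indicator_apply, if_neg, smul_zero]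
    rw [Nat.mod_eq_of_lt (Finset.mem_range.1 hk)]
    exact hne.symm
  · intro hz
    exact absurd (Finset.mem_range.2 (z.res_lt N)) hz

variable {L : Type*} [Field L] [Algebra F L] {e : AddChar (Zhat p) L}

/-- The character of `t` is constant on cosets at its own level, so any finer level gives the same
sum. This allows one common level in the inversion formula. -/
theorem fourierStieltjes_eq (μ : Distribution p F) {t : Zhat p} {N : ℕ} (h : Zhat.level t ≤ N) :
    fourierStieltjes e μ t =
      ∑ k ∈ Finset.range (p ^ N), algebraMap F L (μ (SB.indicator F N k)) * e (-(k • t)) := by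
  have hN : p ^ N = p ^ Zhat.level t * p ^ (N - Zhat.level t) := by
    rw [← pow_add, Nat.add_sub_cancel' h]
  rw [hN, sum_range_mul, fourierStieltjes]
  refine Finset.sum_congr rfl fun q hq => ?_
  have h1 : ∀ s, (q + p ^ Zhat.level t * s) • t = q • t := fun s => by
    rw [add_smul, mul_comm, mul_smul, Zhat.level_mem, smul_zero, add_zero]
  simp only [h1]
  rw [← Finset.sum_mul, ← map_sum, ← map_sum, SB.sum_indicator h (Finset.mem_range.1 hq)]

theorem sum_char_sub (he : Function.Injective e) {N k l : ℕ} (hk : k < p ^ N) (hl : l < p ^ N) :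
    ∑ j ∈ Finset.range (p ^ N), e (k • Zhat.frac p N j) * e (-(l • Zhat.frac p N j)) =
      if k = l then (p : L) ^ N else 0 := by
  have h1 : ∀ j, e (k • Zhat.frac p N j) * e (-(l • Zhat.frac p N j)) =
      e (((k : ℤ) - l) • Zhat.frac p N j) := fun j => by
    rw [← AddChar.map_add_eq_mul, ← sub_eq_add_neg, sub_smul, natCast_zsmul, natCast_zsmul]
  simp only [h1]
  rw [sum_char_frac he]
  refine if_congr ?_ rfl rfl
  rw [← Nat.cast_pow, ← Int.modEq_iff_dvd, Int.natCast_modEq_iff]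
  exact ⟨fun h => (h.eq_of_lt_of_lt hl hk).symm, fun h => h ▸ rfl⟩

theorem frac_comm (N k j : ℕ) : k • Zhat.frac p N j = j • Zhat.frac p N k := by
  rw [Zhat.frac_eq_smul N j, Zhat.frac_eq_smul N k, smul_comm]

theorem fourierStieltjes_inversion (he : Function.Injective e) (μ : Distribution p F) {N l : ℕ}
    (hl : l < p ^ N) :
    ∑ j ∈ Finset.range (p ^ N), fourierStieltjes e μ (Zhat.frac p N j) * e (l • Zhat.frac p N j) =
      (p : L) ^ N * algebraMap F L (μ (SB.indicator F N l)) := by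
  simp only [fourierStieltjes_eq μ (Zhat.level_frac_le N _), Finset.sum_mul]
  rw [Finset.sum_comm]
  have h1 : ∀ k ∈ Finset.range (p ^ N), ∑ j ∈ Finset.range (p ^ N),
      algebraMap F L (μ (SB.indicator F N k)) * e (-(k • Zhat.frac p N j)) *
        e (l • Zhat.frac p N j) =
      if l = k then algebraMap F L (μ (SB.indicator F N k)) * (p : L) ^ N else 0 := by
    intro k hk
    rw [← mul_ite_zero, ← sum_char_sub he hl (Finset.mem_range.1 hk), Finset.mul_sum]
    exact Finset.sum_congr rfl fun j _ => by ring
  rw [Finset.sum_congr rfl h1, Finset.sum_ite_eq, if_pos (Finset.mem_range.2 hl), mul_comm]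

/-- Inversion recovers the mass of every coset because `p` is invertible in `L`, and indicators of
cosets span the locally constant functions. -/
theorem fourierStieltjes_injective (he : Function.Injective e) (hp : (p : L) ≠ 0) :
    Function.Injective (fourierStieltjes (F := F) e) := by
  intro μ ν h
  have hind : ∀ N k, k < p ^ N → μ (SB.indicator F N k) = ν (SB.indicator F N k) := by
    intro N k hk
    have h1 := fourierStieltjes_inversion he μ hk
    rw [h, fourierStieltjes_inversion he ν hk] at h1
    exact ((algebraMap F L).injective (mul_left_cancel₀ (pow_ne_zero N hp) h1)).symm
  refine LinearMap.ext fun φ => ?_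
  obtain ⟨N, hN⟩ := φ.2
  rw [SB.eq_sum_indicator hN, map_sum, map_sum]
  exact Finset.sum_congr rfl fun k hk => by
    rw [map_smul, map_smul, hind N k (Finset.mem_range.1 hk)]

theorem partialSum_ofNat (fh : Zhat p → L) (m N : ℕ) :
    partialSum e fh (Zp.ofNat p m) N =
      ∑ j ∈ Finset.range (p ^ N), fh (Zhat.frac p N j) * e (m • Zhat.frac p N j) := by
  rw [partialSum_eq]
  refine Finset.sum_congr rfl fun j _ => ?_
  congr 2
  conv_rhs => rw [← Nat.mod_add_div m (p ^ N), add_smul, mul_comm, mul_smul, Zhat.smul_frac_self,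
    smul_zero, add_zero]
  rfl

theorem smul_frac_pow (N j : ℕ) : p ^ N • Zhat.frac p (N + 1) j = Zhat.frac p 1 j := by
  induction N with
  | zero => simp
  | succ N ih => rw [pow_succ, mul_smul, Zhat.smul_frac_succ, ih]

/-- Summing over the `p` subcosets of a coset kills the frequencies of exact level `N + 1`. The
remaining numerators are multiples of `p`, that is, the frequencies of level at most `N`. -/
theorem sum_partialSum (he : Function.Injective e) (fh : Zhat p → L) (q N : ℕ) :
    ∑ s ∈ Finset.range p, partialSum e fh (Zp.ofNat p (q + p ^ N * s)) (N + 1) =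
      p * partialSum e fh (Zp.ofNat p q) N := by
  simp only [partialSum_ofNat]
  rw [Finset.sum_comm, pow_succ', sum_range_mul]
  have h1 : ∀ r ∈ Finset.range p, ∀ i, ∑ s ∈ Finset.range p,
      fh (Zhat.frac p (N + 1) (r + p * i)) *
        e ((q + p ^ N * s) • Zhat.frac p (N + 1) (r + p * i)) =
      if r = 0 then fh (Zhat.frac p N i) * e (q • Zhat.frac p N i) * p else 0 := by
    intro r hr i
    have h2 : ∀ s, e ((q + p ^ N * s) • Zhat.frac p (N + 1) (r + p * i)) =
        e (q • Zhat.frac p (N + 1) (r + p * i)) * e (((r + p * i : ℕ) : ℤ) • Zhat.frac p 1 s) := by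
      intro s
      rw [add_smul, AddChar.map_add_eq_mul, mul_comm (p ^ N), mul_smul, smul_frac_pow, natCast_zsmul,
        frac_comm 1]
    simp only [h2, ← mul_assoc]
    rw [← Finset.mul_sum]
    have h3 := sum_char_frac he 1 ((r + p * i : ℕ) : ℤ)
    simp only [pow_one] at h3
    rw [h3]
    have h4 : (p : ℤ) ∣ ((r + p * i : ℕ) : ℤ) ↔ r = 0 := by
      rw [Int.natCast_dvd_natCast, Nat.dvd_add_left (Nat.dvd_mul_right _ _)]
      refine ⟨fun h => Nat.eq_zero_of_dvd_of_lt h (Finset.mem_range.1 hr), fun h => by simp [h]⟩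
    simp only [h4]
    split_ifs with h5
    · rw [h5, zero_add, Zhat.frac_mul_left]
    · rw [mul_zero]
  rw [Finset.sum_congr rfl fun r hr => Finset.sum_congr rfl fun i _ => h1 r hr i]
  rw [Finset.sum_comm]
  simp only [Finset.sum_ite_eq', Finset.mem_range, NeZero.pos p, if_true]
  rw [← Finset.sum_mul, mul_comm]

/-- The integral of a locally constant function of level `N`, for the distribution with densities
`s z N` at level `N`. -/
def levelIntegral (s : Zp p → ℕ → F) (N : ℕ) (φ : Zp p → F) : F :=
  ((p : F) ^ N)⁻¹ * ∑ k ∈ Finset.range (p ^ N), φ (Zp.ofNat p k) * s (Zp.ofNat p k) N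

/-- Passing from level `N` to `N + 1` replaces each density by the mean over its subcosets, by
`sum_partialSum`, while the integrand is constant there. -/
theorem levelIntegral_eq (he : Function.Injective e) (hp : (p : L) ≠ 0) {fh : Zhat p → L}
    {s : Zp p → ℕ → F} (hs : ∀ z N, algebraMap F L (s z N) = partialSum e fh z N) {φ : Zp p → F}
    {M N : ℕ} (h : ∀ y z : Zp p, y.res M = z.res M → φ y = φ z) (hMN : M ≤ N) :
    levelIntegral s N φ = levelIntegral s M φ := by
  have hpF : (p : F) ≠ 0 := fun h0 => hp (by rw [← map_natCast (algebraMap F L), h0, map_zero])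
  induction N, hMN using Nat.le_induction with
  | base => rfl
  | succ N hMN ih =>
    rw [← ih]
    have h1 : ∀ q, ∑ i ∈ Finset.range p, s (Zp.ofNat p (q + p ^ N * i)) (N + 1) =
        p * s (Zp.ofNat p q) N := fun q => by
      refine (algebraMap F L).injective ?_
      rw [map_sum, map_mul, map_natCast]
      simp only [hs, sum_partialSum he]
    have h2 : ∀ q i, φ (Zp.ofNat p (q + p ^ N * i)) = φ (Zp.ofNat p q) := fun q i => by
      refine h _ _ ?_
      rw [Zp.res_ofNat, Zp.res_ofNat]
      refine Nat.ModEq.symm ((Nat.modEq_iff_dvd' (Nat.le_add_right _ _)).2 ?_)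
      rw [Nat.add_sub_cancel_left]
      exact Dvd.dvd.mul_right (pow_dvd_pow p hMN) i
    rw [levelIntegral, levelIntegral, pow_succ p, sum_range_mul]
    simp only [h2, ← Finset.mul_sum, h1]
    rw [pow_succ, mul_inv, mul_assoc]
    congr 1
    rw [Finset.mul_sum]
    refine Finset.sum_congr rfl fun q _ => ?_
    field_simp

/-- A function on the dual group whose Fourier series has its partial sums in `F` is the
Fourier-Stieltjes transform of a distribution. -/
theorem exists_fourierStieltjes_eq (he : Function.Injective e) (hp : (p : L) ≠ 0)
    {fh : Zhat p → L} {s : Zp p → ℕ → F}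
    (hs : ∀ z N, algebraMap F L (s z N) = partialSum e fh z N) :
    ∃ μ : Distribution p F, fourierStieltjes e μ = fh := by
  classical
  have hpF : (p : F) ≠ 0 := fun h0 => hp (by rw [← map_natCast (algebraMap F L), h0, map_zero])
  -- The chosen levels have no relation under sums and multiples; linearity is checked at a common
  -- larger level.
  choose lev hlev using fun φ : SB p F => φ.2
  have hlarge : ∀ (φ : SB p F) (N : ℕ), lev φ ≤ N →
      levelIntegral s (lev φ) φ = levelIntegral s N φ := fun φ N hN =>
    (levelIntegral_eq he hp hs (hlev φ) hN).symm
  let μ : Distribution p F :=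
    { toFun := fun φ => levelIntegral s (lev φ) φ
      map_add' := fun φ ψ => by
        set N := lev φ + lev ψ + lev (φ + ψ) with hN
        rw [hlarge φ N (by omega), hlarge ψ N (by omega), hlarge (φ + ψ) N (by omega)]
        simp [levelIntegral, add_mul, Finset.sum_add_distrib, mul_add]
      map_smul' := fun c φ => by
        set N := lev φ + lev (c • φ) with hN
        rw [hlarge φ N (by omega), hlarge (c • φ) N (by omega)]
        simp only [levelIntegral, Submodule.coe_smul, Pi.smul_apply, smul_eq_mul,
          RingHom.id_apply, Finset.mul_sum]
        exact Finset.sum_congr rfl fun k _ => by ring }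
  have hμ : ∀ (N k : ℕ), k < p ^ N →
      μ (SB.indicator F N k) = ((p : F) ^ N)⁻¹ * s (Zp.ofNat p k) N := by
    intro N k hk
    have h1 : ∀ y z : Zp p, y.res N = z.res N →
        (SB.indicator F N k : SB p F).1 y = (SB.indicator F N k : SB p F).1 z := by
      intro y z h
      rw [SB.indicator_apply, SB.indicator_apply, h]
    have h2 : μ (SB.indicator F N k) = levelIntegral s N (SB.indicator F N k : SB p F) := by
      refine (hlarge _ (max (lev (SB.indicator F N k)) N) (le_max_left _ _)).trans ?_
      exact levelIntegral_eq he hp hs h1 (le_max_right _ _)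
    rw [h2, levelIntegral]
    congr 1
    rw [Finset.sum_eq_single k]
    · rw [SB.indicator_apply, Zp.res_ofNat, if_pos rfl, one_mul]
    · intro l hl hne
      rw [SB.indicator_apply, Zp.res_ofNat, Nat.mod_eq_of_lt (Finset.mem_range.1 hl),
        Nat.mod_eq_of_lt hk, if_neg hne, zero_mul]
    · intro h
      exact absurd (Finset.mem_range.2 hk) h
  refine ⟨μ, funext fun t => ?_⟩
  -- Write `t` as `j / p ^ N`. Exchanging frequencies and positions by `frac_comm`, the claim
  -- becomes finite inversion.
  obtain ⟨j, hj, ht⟩ := Zhat.exists_frac (le_refl (Zhat.level t))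
  set N := Zhat.level t with hN
  rw [fourierStieltjes_eq μ hN.ge]
  have h1 : ∀ k ∈ Finset.range (p ^ N), algebraMap F L (μ (SB.indicator F N k)) * e (-(k • t)) =
      ∑ i ∈ Finset.range (p ^ N), ((p : L) ^ N)⁻¹ * fh (Zhat.frac p N i) *
        (e (i • Zhat.frac p N k) * e (-(j • Zhat.frac p N k))) := by
    intro k hk
    rw [hμ N k (Finset.mem_range.1 hk), map_mul, hs, partialSum_ofNat, map_inv₀, map_pow,
      map_natCast, ht, frac_comm N k j, Finset.mul_sum, Finset.sum_mul]
    refine Finset.sum_congr rfl fun i _ => ?_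
    rw [frac_comm N k i]
    ring
  rw [Finset.sum_congr rfl h1, Finset.sum_comm]
  simp only [← Finset.mul_sum]
  have h2 : ∀ i ∈ Finset.range (p ^ N), ((p : L) ^ N)⁻¹ * fh (Zhat.frac p N i) *
      ∑ k ∈ Finset.range (p ^ N), e (i • Zhat.frac p N k) * e (-(j • Zhat.frac p N k)) =
      if i = j then fh t else 0 := by
    intro i hi
    rw [sum_char_sub he (Finset.mem_range.1 hi) hj]
    split_ifs with h
    · rw [h, ← ht]
      field_simp
    · rw [mul_zero]
  rw [Finset.sum_congr rfl h2, Finset.sum_ite_eq', if_pos (Finset.mem_range.2 hj)]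

end Distributions

/-! ### Linearity of the transform. -/

section Algebra

variable {d p : ℕ} [NeZero p] {F : Type*} [Field F] {L : Type*} [Field L] [Algebra F L]
  (k : Type*) [Field k] [Algebra k F] [Algebra k L] [IsScalarTower k F L]

/-- The Fourier-Stieltjes transform as a linear map. -/
def fourierStieltjesHom (e : AddChar (Zhat p) L) : Distribution p F →ₗ[k] (Zhat p → L) where
  toFun := fourierStieltjes e
  map_add' μ ν := funext fun t => by
    simp [fourierStieltjes, add_mul, Finset.sum_add_distrib]
  map_smul' c μ := funext fun t => by
    simp only [fourierStieltjes, LinearMap.smul_apply, RingHom.id_apply, Pi.smul_apply,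
      Finset.smul_sum]
    refine Finset.sum_congr rfl fun i _ => ?_
    rw [Algebra.smul_def, map_mul, ← IsScalarTower.algebraMap_apply, Algebra.smul_def, mul_assoc]

end Algebra

/-! ### Realizations of polynomials and formal products. -/

section FormalProduct

variable {d : ℕ} {k : Type*} [Field k] {V W : Type*} [AddCommGroup V] [Module k V]
  [AddCommGroup W] [Module k W]

theorem map_realize (f : V →ₗ[k] W) (v : (Fin d → ℕ) → V) (P : MvPolynomial (Fin d) k) :
    f (realize k v P) = realize k (fun n => f (v n)) P := by
  induction P using MvPolynomial.induction_on' with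
  | monomial n c => rw [realize_monomial, realize_monomial, map_smul]
  | add P Q hP hQ => rw [map_add, map_add, map_add, hP, hQ]

theorem realize_eq_sum (v : (Fin d → ℕ) → V) (P : MvPolynomial (Fin d) k) :
    realize k v P = ∑ n ∈ P.support, P.coeff n • v n := by
  conv_lhs => rw [P.as_sum, map_sum]
  simp only [realize_monomial]

theorem range_realize (v : (Fin d → ℕ) → V) :
    LinearMap.range (realize k v) = Submodule.span k (Set.range v) := by
  refine le_antisymm ?_ (Submodule.span_le.2 ?_)
  · rintro _ ⟨P, rfl⟩
    rw [realize_eq_sum]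
    exact Submodule.sum_mem _ fun n _ =>
      Submodule.smul_mem _ _ (Submodule.subset_span ⟨_, rfl⟩)
  · rintro _ ⟨n, rfl⟩
    exact ⟨_, realize_prod_X k v n⟩

/-- A linear isomorphism of the spans of two families that matches the families carries formal
products to formal products. -/
theorem IsFormalProduct.transfer {v : (Fin d → ℕ) → V} {w : (Fin d → ℕ) → W}
    (Φ : Submodule.span k (Set.range v) ≃ₗ[k] Submodule.span k (Set.range w))
    (hΦ : ∀ n, (Φ ⟨v n, Submodule.subset_span ⟨n, rfl⟩⟩ : W) = w n) {mul}
    (h : IsFormalProduct k v mul) :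
    ∃ mul', IsFormalProduct k w mul' ∧ ∀ x y, Φ (mul x y) = mul' (Φ x) (Φ y) := by
  have hΦ' : ∀ n, Φ ⟨v n, Submodule.subset_span ⟨n, rfl⟩⟩ =
      ⟨w n, Submodule.subset_span ⟨n, rfl⟩⟩ := fun n => Subtype.ext (hΦ n)
  refine ⟨(mul.compl₁₂ Φ.symm.toLinearMap Φ.symm.toLinearMap).compr₂ Φ.toLinearMap,
    fun m n => ?_, fun x y => ?_⟩
  · rw [← hΦ', ← hΦ', ← hΦ', ← h]
    simp
  · simp

/-- If the realization is injective, the formal product is well-defined, and the realization is an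
isomorphism of algebras onto its span. -/
theorem exists_formalProduct {v : (Fin d → ℕ) → V}
    (hinj : Function.Injective (realize k v)) :
    ∃ mul, IsFormalProduct k v mul ∧
      ∃ ψ : MvPolynomial (Fin d) k ≃ₗ[k] Submodule.span k (Set.range v),
        (∀ P, (ψ P : V) = realize k v P) ∧ ∀ P Q, ψ (P * Q) = mul (ψ P) (ψ Q) := by
  let ψ : MvPolynomial (Fin d) k ≃ₗ[k] Submodule.span k (Set.range v) :=
    (LinearEquiv.ofInjective _ hinj).trans (LinearEquiv.ofEq _ _ (range_realize v))
  have hψ : ∀ P, (ψ P : V) = realize k v P := fun P => rfl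
  have hX : ∀ n : Fin d → ℕ, (⟨v n, Submodule.subset_span ⟨n, rfl⟩⟩ :
      Submodule.span k (Set.range v)) = ψ (∏ j, MvPolynomial.X j ^ n j) := fun n =>
    Subtype.ext (by rw [hψ, realize_prod_X])
  refine ⟨((LinearMap.mul k (MvPolynomial (Fin d) k)).compl₁₂ ψ.symm.toLinearMap
    ψ.symm.toLinearMap).compr₂ ψ.toLinearMap, fun m n => ?_, ψ, hψ, fun P Q => ?_⟩
  · rw [hX, hX, hX]
    simp [pow_add, Finset.prod_mul_distrib]
  · simp

end FormalProduct

/-! ### Fourier series of polynomials in the X_j. -/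

section Eval

variable {d p : ℕ} [NeZero p] {F : Type*} [Field F] (k : Type*) [Field k] [Algebra k F]

theorem evalCompl_eq (w : AbsoluteValue F ℝ) (x : Fin d → UniformSpace.Completion (WithAbs w))
    (P : MvPolynomial (Fin d) k) :
    evalCompl k w x P =
      ∑ n ∈ P.support, complHom w (algebraMap k F (P.coeff n)) * ∏ j, x j ^ n j :=
  MvPolynomial.eval₂_eq' _ _ _

theorem evalCompl_complHom (w : AbsoluteValue F ℝ) (x : Fin d → F) (P : MvPolynomial (Fin d) k) :
    evalCompl k w (fun j => complHom w (x j)) P = complHom w (MvPolynomial.aeval x P) := by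
  rw [evalCompl_eq, MvPolynomial.aeval_def, MvPolynomial.eval₂_eq']
  simp

variable {k} {L : Type*} [Field L] [Algebra F L] [Algebra k L] [IsScalarTower k F L]

theorem partialSum_realize (e : AddChar (Zhat p) L) (v : (Fin d → ℕ) → Zhat p → L)
    (P : MvPolynomial (Fin d) k) (z : Zp p) (N : ℕ) :
    partialSum e (realize k v P) z N =
      ∑ n ∈ P.support, algebraMap k L (P.coeff n) * partialSum e (v n) z N := by
  have h : realize k v P = fun t => ∑ n ∈ P.support, algebraMap k L (P.coeff n) * v n t := by
    rw [realize_eq_sum]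
    funext t
    simp [Algebra.smul_def]
  rw [h, partialSum_sum]
  simp only [partialSum_const_mul]

/-- If the Fourier series of all monomials converge, so do those of all polynomials. -/
theorem tendsto_realize {e : AddChar (Zhat p) L} {v : (Fin d → ℕ) → Zhat p → L} {z : Zp p}
    {w : AbsoluteValue F ℝ} {s : (Fin d → ℕ) → ℕ → F} {x : Fin d → UniformSpace.Completion (WithAbs w)}
    (hs : ∀ n N, algebraMap F L (s n N) = partialSum e (v n) z N)
    (hlim : ∀ n, Tendsto (fun N => complHom w (s n N)) atTop (𝓝 (∏ j, x j ^ n j)))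
    (P : MvPolynomial (Fin d) k) :
    FourierSeriesTendsto e (realize k v P) z w (evalCompl k w x P) := by
  refine ⟨fun N => ∑ n ∈ P.support, algebraMap k F (P.coeff n) * s n N, fun N => ?_, ?_⟩
  · rw [partialSum_realize, map_sum]
    simp only [map_mul, hs, ← IsScalarTower.algebraMap_apply]
  · rw [evalCompl_eq]
    refine (tendsto_finsetSum P.support fun n _ => (hlim n).const_mul
      (complHom w (algebraMap k F (P.coeff n)))).congr fun N => ?_
    simp only [← map_mul, ← map_sum]
    rfl

/-- The partial sums are determined as elements of `F`, since `F → L` is injective, and the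
completion is Hausdorff. -/
theorem FourierSeriesTendsto.unique {e : AddChar (Zhat p) L} {fh : Zhat p → L} {z : Zp p}
    {w : AbsoluteValue F ℝ} {x y : UniformSpace.Completion (WithAbs w)}
    (hx : FourierSeriesTendsto e fh z w x) (hy : FourierSeriesTendsto e fh z w y) : x = y := by
  obtain ⟨s, hs, hsx⟩ := hx
  obtain ⟨s', hs', hsy⟩ := hy
  have : s = s' := funext fun N => (algebraMap F L).injective ((hs N).trans (hs' N).symm)
  subst this
  exact tendsto_nhds_unique hsx hsy

theorem fourierSeriesTendsto_zero (e : AddChar (Zhat p) L) (z : Zp p) (w : AbsoluteValue F ℝ) :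
    FourierSeriesTendsto e 0 z w 0 := by
  refine ⟨fun _ => 0, fun N => by simp [partialSum], ?_⟩
  have : ((WithAbs.toAbs w 0 : WithAbs w) : UniformSpace.Completion (WithAbs w)) = 0 :=
    map_zero (complHom w)
  simp only [this]
  exact tendsto_const_nhds

end Eval

/-! ### A global field is the field of fractions of its ring of integers. -/

section GlobalField

variable {K : Type*} [Field K]

theorem isFractionRing_of_isIntegral {R : Type*} [CommRing R] [Algebra R K]
    (hinj : Function.Injective (algebraMap R K)) [Algebra.IsAlgebraic R K] {O : Subring K}
    (hO : ∀ x : K, x ∈ O ↔ IsIntegral R x) : IsFractionRing O K := by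
  refine IsFractionRing.of_field O K fun z => ?_
  obtain ⟨y, hy, hz⟩ := (Algebra.IsAlgebraic.isAlgebraic (R := R) z).exists_integral_multiple
  refine ⟨⟨y • z, (hO _).2 hz⟩, ⟨algebraMap R K y, (hO _).2 isIntegral_algebraMap⟩, ?_⟩
  change z = y • z / algebraMap R K y
  rw [Algebra.smul_def, mul_div_cancel_left₀ _ ((map_ne_zero_iff _ hinj).2 hy)]

/-- The hypotheses make `k` the field of fractions of `A`, and being algebraic does not distinguish
a domain from its field of fractions. -/
theorem isAlgebraic_of_subfield {A : Subring K} {k : Subfield K} (hsub : ∀ x ∈ A, x ∈ k)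
    (hf : ∀ x ∈ k, ∃ y ∈ A, ∃ z ∈ A, y / z = x) [Algebra.IsAlgebraic k K] :
    Algebra.IsAlgebraic A K := by
  let _ : Algebra A k := (A.subtype.codRestrict k fun x => hsub x x.2).toAlgebra
  have _ : IsScalarTower A k K := IsScalarTower.of_algebraMap_eq fun _ => rfl
  have hval : ∀ y : A, ((algebraMap A k y : k) : K) = y := fun _ => rfl
  have hfrac : IsFractionRing A k := by
    have hinj : Function.Injective (algebraMap A k) := fun x y h => by
      rw [Subtype.ext_iff, hval, hval] at h
      exact Subtype.ext h
    have : FaithfulSMul A k := (faithfulSMul_iff_algebraMap_injective A k).2 hinj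
    refine IsFractionRing.of_field A k fun x => ?_
    obtain ⟨y, hy, z, hz, h⟩ := hf x x.2
    refine ⟨⟨y, hy⟩, ⟨z, hz⟩, Subtype.ext ?_⟩
    rw [Subfield.coe_div, hval, hval, h]
  exact (IsFractionRing.comap_isAlgebraic_iff (A := A) (K := k) (C := K)).2 inferInstance

theorem IsGlobalFieldWithIntegers.isFractionRing {O : Subring K}
    (hK : IsGlobalFieldWithIntegers K O) : IsFractionRing O K := by
  rcases hK with ⟨_, hO⟩ | ⟨-, t, -, hfin, hO⟩
  · have : Algebra.IsAlgebraic ℤ K :=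
      (IsFractionRing.comap_isAlgebraic_iff (A := ℤ) (K := ℚ) (C := K)).2 inferInstance
    exact isFractionRing_of_isIntegral (RingHom.injective_int _) hO
  · have : Algebra.IsAlgebraic (Subring.closure {t}) K :=
      isAlgebraic_of_subfield (k := Subfield.closure {t})
        (fun x hx => Subfield.mem_closure_iff.2 ⟨x, hx, 1, one_mem _, div_one x⟩)
        (fun _ hx => Subfield.mem_closure_iff.1 hx)
    exact isFractionRing_of_isIntegral Subtype.val_injective hO

end GlobalField

/-! ### The rings of parameters and their specializations. -/

section ParamRings

variable {d p : ℕ} [NeZero p] {O : Type*} [CommRing O]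

/-- The class of the polynomial variable `x_j`, the inverse of `1 - a_{j,0}`. -/
def locInv (j : Fin d) : LocRing d p O := Ideal.Quotient.mk (locIdeal d p O) (MvPolynomial.X j)

theorem mul_locInv (j : Fin d) :
    algebraMap (ParamRing d p O) (LocRing d p O) (1 - parA O j 0) * locInv j = 1 := by
  have h : MvPolynomial.C (1 - parA O j (0 : Fin p)) * MvPolynomial.X j - 1 ∈ locIdeal d p O :=
    Ideal.subset_span ⟨j, rfl⟩
  exact (Ideal.Quotient.eq (I := locIdeal d p O)).2 h

/-- A homomorphism from `R_d` that maps `1 - a_{j,0}` to units extends to the localization. -/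
def locLift {S : Type*} [CommRing S] (f : ParamRing d p O →+* S) (y : Fin d → S)
    (h : ∀ j, f (1 - parA O j 0) * y j = 1) : LocRing d p O →+* S :=
  Ideal.Quotient.lift (locIdeal d p O) (MvPolynomial.eval₂Hom f y) (by
    intro x hx
    refine (Ideal.span_le (I := RingHom.ker (MvPolynomial.eval₂Hom f y))).2 ?_ hx
    rintro _ ⟨j, rfl⟩
    change MvPolynomial.eval₂Hom f y _ = 0
    rw [map_sub, map_mul, MvPolynomial.eval₂Hom_C, MvPolynomial.eval₂Hom_X', h, map_one, sub_self])

theorem locLift_algebraMap {S : Type*} [CommRing S] (f : ParamRing d p O →+* S) (y : Fin d → S)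
    (h : ∀ j, f (1 - parA O j 0) * y j = 1) (r : ParamRing d p O) :
    locLift f y h (algebraMap (ParamRing d p O) (LocRing d p O) r) = f r :=
  MvPolynomial.eval₂Hom_C f y r

/-- The localization maps to the field of fractions of the polynomial ring, where an indeterminate
remains nonzero. -/
theorem algebraMap_parA_ne_zero [IsDomain O] (j : Fin d) :
    algebraMap (ParamRing d p O) (LocRing d p O) (parA O j 0) ≠ 0 := by
  have h1 : ∀ j : Fin d, (1 - parA O j 0 : ParamRing d p O) ≠ 0 := fun j h => by
    have := congrArg (MvPolynomial.eval fun _ => (0 : O)) h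
    simp [parA] at this
  let f := algebraMap (ParamRing d p O) (FractionRing (ParamRing d p O))
  have hf : Function.Injective f := IsFractionRing.injective _ _
  intro h
  have h2 := congrArg (locLift f (fun j => (f (1 - parA O j 0))⁻¹) fun j =>
    mul_inv_cancel₀ ((map_ne_zero_iff f hf).2 (h1 j))) h
  rw [locLift_algebraMap, map_zero, map_eq_zero_iff f hf] at h2
  exact MvPolynomial.X_ne_zero _ h2

theorem isUnit_one_sub_quotA (I : Ideal (ParamRing d p O)) (j : Fin d) :
    IsUnit (1 - quotA I j 0) := by
  have h := congrArg (Ideal.Quotient.mk (extendedIdeal I)) (mul_locInv (p := p) (O := O) j)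
  rw [map_mul, map_sub, map_one, map_sub, map_one] at h
  exact IsUnit.of_mul_eq_one _ h

/-- The specialization `a_{j,k} = 0`, `b_{j,0} = x_j`, and `b_{j,k} = 0` for `k ≠ 0`, of the
parameters. -/
def paramSpecialize (d p : ℕ) [NeZero p] (O : Type*) [CommRing O] :
    ParamRing d p O →+* MvPolynomial (Fin d) O :=
  MvPolynomial.eval₂Hom MvPolynomial.C
    (Sum.elim (fun _ => 0) fun i => if i.2 = 0 then MvPolynomial.X i.1 else 0)

theorem paramSpecialize_mul_one (j : Fin d) :
    paramSpecialize d p O (1 - parA O j 0) * 1 = 1 := by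
  simp [paramSpecialize, parA]

/-- The specialization of the parameters, on the quotient ring for the zero ideal. -/
def specialize (d p : ℕ) [NeZero p] (O : Type*) [CommRing O] :
    QuotRing (⊥ : Ideal (ParamRing d p O)) →+* MvPolynomial (Fin d) O :=
  Ideal.Quotient.lift _ (locLift (paramSpecialize d p O) (fun _ => 1) paramSpecialize_mul_one) (by
    intro x hx
    have h : extendedIdeal (⊥ : Ideal (ParamRing d p O)) = ⊥ := Ideal.map_bot
    rw [h, Ideal.mem_bot] at hx
    rw [hx, map_zero])

theorem specialize_toQuot (r : ParamRing d p O) :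
    specialize d p O (toQuot ⊥ r) = paramSpecialize d p O r :=
  locLift_algebraMap _ _ paramSpecialize_mul_one r

/-- The homomorphism `c ↦ c` from `O` to the quotient ring. -/
def constHom (I : Ideal (ParamRing d p O)) : O →+* QuotRing I :=
  (Ideal.Quotient.mk (extendedIdeal I)).comp
    ((algebraMap (ParamRing d p O) (LocRing d p O)).comp MvPolynomial.C)

theorem specialize_constHom (c : O) : specialize d p O (constHom ⊥ c) = MvPolynomial.C c :=
  (specialize_toQuot _).trans (by simp [paramSpecialize])

theorem constHom_injective : Function.Injective (constHom (⊥ : Ideal (ParamRing d p O))) := by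
  intro c c' h
  have := congrArg (specialize d p O) h
  rw [specialize_constHom, specialize_constHom] at this
  exact MvPolynomial.C_injective _ _ this

/-- The equation is the fixed-point equation of X_j(0); the specialization sends `a_{j,0}` to 0 and
`b_{j,0}` to the variable. -/
theorem specialize_eq_X {j : Fin d} {x : QuotRing (⊥ : Ideal (ParamRing d p O))}
    (h : x = quotA ⊥ j 0 * x + quotB ⊥ j 0) : specialize d p O x = MvPolynomial.X j := by
  rw [h, map_add, map_mul]
  simp [quotA, quotB, specialize_toQuot, paramSpecialize, parA, parB]

/-- Values whose specializations are the variables are algebraically independent. -/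
theorem eq_zero_of_aeval_eq_zero [IsDomain O] {K F : Type*} [Field K] [Algebra O K]
    [IsFractionRing O K]
    [Field F] [Algebra (QuotRing (⊥ : Ideal (ParamRing d p O))) F]
    [IsFractionRing (QuotRing (⊥ : Ideal (ParamRing d p O))) F] [Algebra K F]
    (hKF : ∀ c : O, algebraMap K F (algebraMap O K c) =
      algebraMap (QuotRing (⊥ : Ideal (ParamRing d p O))) F (constHom ⊥ c))
    {x : Fin d → QuotRing (⊥ : Ideal (ParamRing d p O))}
    (hx : ∀ j, specialize d p O (x j) = MvPolynomial.X j) {P : MvPolynomial (Fin d) K}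
    (hP : MvPolynomial.aeval (fun j => algebraMap _ F (x j)) P = 0) : P = 0 := by
  -- A common denominator of the coefficients of `P`: the specialization is defined over `O`, not
  -- over `K`.
  obtain ⟨c, hc⟩ := IsLocalization.exist_integer_multiples (nonZeroDivisors O) P.support P.coeff
  have hc0 : algebraMap O K c ≠ 0 := IsFractionRing.to_map_ne_zero_of_mem_nonZeroDivisors c.2
  obtain ⟨Q, hQ⟩ : ∃ Q : MvPolynomial (Fin d) O,
      MvPolynomial.map (algebraMap O K) Q = MvPolynomial.C (algebraMap O K c) * P := by
    rw [← Set.mem_range, ← RingHom.coe_range, SetLike.mem_coe]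
    rw [P.as_sum, Finset.mul_sum]
    refine sum_mem fun n hn => ?_
    obtain ⟨q, hq⟩ := hc n hn
    refine ⟨MvPolynomial.monomial n q, ?_⟩
    rw [MvPolynomial.map_monomial, hq, MvPolynomial.C_mul_monomial, Algebra.smul_def]
  have h1 : algebraMap _ F (MvPolynomial.eval₂ (constHom ⊥) x Q) = 0 := by
    have h2 := congrArg (MvPolynomial.aeval fun j => algebraMap _ F (x j)) hQ
    rw [map_mul, hP, mul_zero, MvPolynomial.aeval_def, MvPolynomial.eval₂_map] at h2
    rw [MvPolynomial.eval₂_comp_left, ← h2]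
    congr 1
    exact RingHom.ext fun c => (hKF c).symm
  rw [map_eq_zero_iff _ (IsFractionRing.injective _ F)] at h1
  have h3 := congrArg (specialize d p O) h1
  rw [MvPolynomial.eval₂_comp_left, map_zero] at h3
  have h4 : (specialize d p O).comp (constHom ⊥) = MvPolynomial.C := RingHom.ext specialize_constHom
  have h5 : specialize d p O ∘ x = MvPolynomial.X := funext hx
  rw [h4, h5, MvPolynomial.eval₂_eta] at h3
  rw [h3, map_zero, eq_comm, mul_eq_zero, MvPolynomial.C_eq_zero] at hQ
  exact hQ.resolve_left hc0

end ParamRings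

theorem fracMap_complHom {R F : Type*} [CommRing R] [Field F] [Algebra R F]
    {v : AbsoluteValue R ℝ} {w : AbsoluteValue F ℝ} (h : Extends v w) (r : R) :
    fracMap v w (complHom v r) = complHom w (algebraMap R F r) :=
  tendsto_nhds_unique (tendsto_fracMap h (tendsto_const_nhds (f := (⊤ : Filter ℕ))))
    tendsto_const_nhds

/-- Decay is proved before passing to the quotient, where `a 0` may become zero and the ratios in
the root condition meaningless; absolute values only decrease in the quotient. -/
theorem Frame.RootCondition.hasDecay_quotient {p : ℕ} [NeZero p] (hp : 2 ≤ p) {E : Set (Zp p)}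
    {R : Type*} [CommRing R] {F : Frame E R} {a : Fin p → R} (h : F.RootCondition a)
    (ha : a 0 ≠ 0) {J : Ideal R} {G : Frame E (R ⧸ J)} (hG : F.IsQuotient J G) :
    G.HasDecay fun k => Ideal.Quotient.mk J (a k) := by
  have : Nontrivial R := ⟨_, _, ha⟩
  intro z
  obtain ⟨ρ, h0, h1, h2⟩ := h.eventually_le hp ha z
  refine ⟨ρ, h0, h1, ?_⟩
  filter_upwards [h2] with N hN
  rw [← Zp.map_digitProd]
  exact (hG.abv_le z _).trans hN

end FSeries

end

/-! ### The main theorem. -/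

open FSeries in
theorem mainTheorem1
    (d p : ℕ) [NeZero p] (hd : 1 ≤ d) (hp : 2 ≤ p)
    {K : Type u} [Field K] (O : Subring K) (hK : IsGlobalFieldWithIntegers K O)
    (hchar : ringChar K = 0 ∨ (ringChar K).Coprime p)
    -- a digital frame that satisfies the root condition
    {D : Set (Zp p)} (𝓕 : Frame D (LocRing d p O))
    (hreff : 𝓕.IsReffinite) (hdig : 𝓕.IsDigital)
    (hroot : ∀ j : Fin d, 𝓕.RootCondition
      (fun k => algebraMap (ParamRing d p O) (LocRing d p O) (parA O j k)))
    -- a unique solution ideal, and the quotient frame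
    (I : Ideal (ParamRing d p O)) (hI : ∀ j : Fin d, ¬ Ideal.span {1 - parA O j 0} ≤ I)
    (𝓖 : Frame D (QuotRing I)) (hquot : 𝓕.IsQuotient (extendedIdeal I) 𝓖)
    (hpI : (p : QuotRing I) ≠ 0)
    -- the field of fractions `F`, the field `L = F(ζ_{p^∞})`, and the choice of roots of unity
    (F : Type*) [Field F] [Algebra (QuotRing I) F] [IsFractionRing (QuotRing I) F]
    (L : Type*) [Field L] [Algebra F L]
    [IsCyclotomicExtension (Set.range fun n : ℕ => p ^ n) F L]
    (e : AddChar (Zhat p) L) (he : Function.Injective e) :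
    -- I. existence and uniqueness of the functions `X_j`
    (∀ j, ∃! X : 𝓖.Compat, 𝓖.IsRisingSolution (hreff.quotient hquot) (quotA I j) (quotB I j) X) ∧
    -- the functions `X̂_n` are well-defined by the recursion
    ∃ Xh : (Fin d → ℕ) → Zhat p → L,
      IsFourierFamily e (inExt F L (quotA I)) (inExt F L (quotB I)) Xh ∧
      (∀ Yh, IsFourierFamily e (inExt F L (quotA I)) (inExt F L (quotB I)) Yh → Yh = Xh) ∧
      ∀ X : Fin d → 𝓖.Compat,
        (∀ j, 𝓖.IsRisingSolution (hreff.quotient hquot) (quotA I j) (quotB I j) (X j)) →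
        -- II. `X_n` is quasi-integrable, with Fourier transform `X̂_n`
        (∀ n : Fin d → ℕ,
          IsQuasiIntegrable F 𝓖 e (fun z => ∏ j, X j z ^ n j) ∧
          IsFourierTransform F 𝓖 e (Xh n) (fun z => ∏ j, X j z ^ n j)) ∧
        -- III. `X̂_n` is the Fourier-Stieltjes transform of a unique distribution `X_n dz`
        ∃ μ : (Fin d → ℕ) → Distribution p F,
          (∀ n, fourierStieltjes e (μ n) = Xh n ∧
            ∀ ν : Distribution p F, fourierStieltjes e ν = Xh n → ν = μ n) ∧
          -- the polynomial algebra over any field of coefficients `k` (for example `K`, if it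
          -- embeds), and its two realizations
          (∀ (k : Type u) [Field k] [Algebra k F] [Algebra k L] [IsScalarTower k F L],
            (∀ P : MvPolynomial (Fin d) k,
              fourierStieltjes e (realize k μ P) = realize k Xh P ∧
              IsFourierTransformOfPolynomial k F 𝓖 e (realize k Xh P) X P) ∧
            -- the transform is an isomorphism between the spans, which matches the products
            ∃ Φ : Submodule.span k (Set.range μ) ≃ₗ[k] Submodule.span k (Set.range Xh),
              (∀ x, (Φ x : Zhat p → L) = fourierStieltjes e (x : Distribution p F)) ∧
              (∀ mulD, IsFormalProduct k μ mulD → ∃ mulC, IsFormalProduct k Xh mulC ∧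
                ∀ x y, Φ (mulD x y) = mulC (Φ x) (Φ y)) ∧
              (∀ mulC, IsFormalProduct k Xh mulC → ∃ mulD, IsFormalProduct k μ mulD ∧
                ∀ x y, Φ (mulD x y) = mulC (Φ x) (Φ y)) ∧
              -- free polynomial algebra, if the functions `X_j` are algebraically independent
              (FunctionsAlgIndependent k F 𝓖 X →
                ∃ mulD, IsFormalProduct k μ mulD ∧
                  ∃ ψ : MvPolynomial (Fin d) k ≃ₗ[k] Submodule.span k (Set.range μ),
                    (∀ P, (ψ P : Distribution p F) = realize k μ P) ∧
                    ∀ P Q, ψ (P * Q) = mulD (ψ P) (ψ Q))) ∧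
          -- for indeterminate parameters they are algebraically independent over `K`
          (I = ⊥ → ∃ _ : Algebra K F,
            (∀ c : O, algebraMap K F c =
              algebraMap (QuotRing I) F (toQuot I (MvPolynomial.C c))) ∧
            FunctionsAlgIndependent K F 𝓖 X) := by
  classical
  have hfracK : IsFractionRing O K := hK.isFractionRing
  have hinjF : Function.Injective (algebraMap (QuotRing I) F) := IsFractionRing.injective _ F
  have hpL : (p : L) ≠ 0 := by
    rw [← map_natCast (algebraMap F L), map_ne_zero_iff _ (algebraMap F L).injective,
      ← map_natCast (algebraMap (QuotRing I) F), map_ne_zero_iff _ hinjF]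
    exact hpI
  have hdec : ∀ j, 𝓖.HasDecay (quotA I j) := fun j =>
    (hroot j).hasDecay_quotient hp (algebraMap_parA_ne_zero j) hquot
  have hfam := isFourierFamily_fourierFamily e (inExt F L (quotA I)) (inExt F L (quotB I))
  refine ⟨fun j => (hdec j).existsUnique_isRisingSolution hp _ _ (isUnit_one_sub_quotA I j),
    fourierFamily e (inExt F L (quotA I)) (inExt F L (quotB I)), hfam,
    fun Yh hY => hY.unique hfam, fun X hX => ?_⟩
  set Xh := fourierFamily e (inExt F L (quotA I)) (inExt F L (quotB I))
  obtain ⟨s, hs, hlim⟩ := hfam.exists_tendsto (G := 𝓖) F he hpL hdec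
  replace hlim := hlim X fun j z => (hX j).tendsto hp (hdec j) z
  have hFT : ∀ n : Fin d → ℕ, IsFourierTransform F 𝓖 e (Xh n) (fun z => ∏ j, X j z ^ n j) := by
    intro n z
    obtain ⟨w, hw⟩ := exists_extends F (𝓖.abv z)
    refine ⟨w, hw, s n z.1, hs n z.1, ?_⟩
    rw [fracMap_prod_pow hw]
    exact hlim n z w hw
  choose μ hμ using fun n => exists_fourierStieltjes_eq he hpL (hs n)
  have hinj := fourierStieltjes_injective (F := F) he hpL
  refine ⟨fun n => ⟨⟨_, hFT n⟩, hFT n⟩, μ, fun n => ⟨hμ n, fun ν hν =>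
    hinj (hν.trans (hμ n).symm)⟩, ?_, ?_⟩
  · intro k _ _ _ _
    have hreal : ∀ P : MvPolynomial (Fin d) k,
        fourierStieltjes e (realize k μ P) = realize k Xh P := fun P => by
      have := map_realize (fourierStieltjesHom k e) μ P
      rwa [show (fun n => fourierStieltjesHom k e (μ n)) = Xh from funext hμ] at this
    have hser : ∀ (P : MvPolynomial (Fin d) k) (z : D) (w : AbsoluteValue F ℝ),
        Extends (𝓖.abv z) w → FourierSeriesTendsto e (realize k Xh P) z.1 w
          (evalCompl k w (fun j => fracMap (𝓖.abv z) w (X j z)) P) := fun P z w hw =>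
      tendsto_realize (fun n => hs n z.1) (fun n => hlim n z w hw) P
    have hinjk : Function.Injective (fourierStieltjesHom (F := F) k e) := hinj
    have hmap : (Submodule.span k (Set.range μ)).map (fourierStieltjesHom k e) =
        Submodule.span k (Set.range Xh) := by
      rw [Submodule.map_span, ← Set.range_comp]
      exact congrArg (fun f => Submodule.span k (Set.range f)) (funext hμ)
    let Φ := (Submodule.equivMapOfInjective (fourierStieltjesHom k e) hinjk
      (Submodule.span k (Set.range μ))).trans (LinearEquiv.ofEq _ _ hmap)
    have hΦ : ∀ x, (Φ x : Zhat p → L) = fourierStieltjes e (x : Distribution p F) := fun _ => rfl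
    refine ⟨fun P => ⟨hreal P, fun z => ?_⟩, Φ, hΦ, fun mulD hD => ?_, fun mulC hC => ?_,
      fun hind => ?_⟩
    · obtain ⟨w, hw⟩ := exists_extends F (𝓖.abv z)
      exact ⟨w, hw, hser P z w hw⟩
    · exact hD.transfer Φ fun n => (hΦ _).trans (hμ n)
    -- The converse direction is the transfer along the inverse isomorphism.
    · obtain ⟨mulD, hD, h⟩ := hC.transfer Φ.symm fun n => by
        have h1 : Φ ⟨μ n, Submodule.subset_span ⟨n, rfl⟩⟩ =
            ⟨Xh n, Submodule.subset_span ⟨n, rfl⟩⟩ := Subtype.ext ((hΦ _).trans (hμ n))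
        rw [← h1, LinearEquiv.symm_apply_apply]
      refine ⟨mulD, hD, fun x y => ?_⟩
      have h2 := h (Φ x) (Φ y)
      rw [LinearEquiv.symm_apply_apply, LinearEquiv.symm_apply_apply] at h2
      rw [← h2, LinearEquiv.apply_symm_apply]
    -- If `P` is realized by the zero distribution, its Fourier series is zero, but it also
    -- converges to P(X_1, …, X_d); independence then gives `P = 0`.
    · refine exists_formalProduct ((injective_iff_map_eq_zero _).2 fun P hP => hind P ?_)
      intro z w hw
      have h1 : realize k Xh P = 0 := by
        rw [← hreal, hP]
        exact map_zero (fourierStieltjesHom k e)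
      have h2 := hser P z w hw
      rw [h1] at h2
      exact h2.unique (fourierSeriesTendsto_zero e z.1 w)
  · rintro rfl
    have hOF : Function.Injective
        ((algebraMap (QuotRing (⊥ : Ideal (ParamRing d p O))) F).comp (constHom ⊥)) :=
      hinjF.comp constHom_injective
    let _ : Algebra K F := (IsFractionRing.lift hOF).toAlgebra
    have hKF : ∀ c : O, algebraMap K F (algebraMap O K c) =
        algebraMap (QuotRing (⊥ : Ideal (ParamRing d p O))) F (constHom ⊥ c) := fun c =>
      IsFractionRing.lift_algebraMap hOF c
    refine ⟨inferInstance, hKF, fun P hP => ?_⟩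
    choose f hf hrec _ using fun j => (hX j).exists_recursion hp
    -- The single point 0 suffices: the values there lie in the quotient ring and can be
    -- specialized.
    set z : D := ⟨Zp.ofNat p 0, (hreff.quotient hquot).nat_mem 0⟩
    obtain ⟨w, hw⟩ := exists_extends F (𝓖.abv z)
    have h1 := hP z w hw
    have h2 : (fun j => fracMap (𝓖.abv z) w (X j z)) =
        fun j => complHom w (algebraMap _ F (f j 0)) := funext fun j => by
      rw [hf j 0]
      exact fracMap_complHom hw _
    rw [h2, evalCompl_complHom] at h1
    refine eq_zero_of_aeval_eq_zero hKF (x := fun j => f j 0) (fun j => specialize_eq_X ?_)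
      ((map_eq_zero_iff _ (complHom_injective w)).1 h1)
    have h3 := hrec j 0
    rwa [Nat.zero_div, digit_ofNat_zero] at h3
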